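/- For every real $\varepsilon > 0$ there exists $k_0(\varepsilon)$ such that for every integer $k \ge k_0(\varepsilon)$, every triangle-free simple graph $G$ (finite or infinite) with chromatic number exactly $k$ has the following two properties, where $\log$ is the natural logarithm. First, $G$ contains a cycle of length at least $(\tfrac14-\varepsilon)k^2\log k$. Second, $G$ contains cycles of at least $(\tfrac1{64}-\varepsilon)k^2\log k$ consecutive lengths; that is, there are non-negative integers $a$ and $m$ with $m \ge (\tfrac1{64}-\varepsilon)k^2\log k$ such that $G$ contains a cycle of each of the lengths $a, a+1, \dots, a+m-1$. -/

import Mathlib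

/-! In a triangle-free graph neighbourhoods are independent, so Shearer's theorem gives among `n`
vertices an independent set of size about `√(n log n / 2)`. Removing such sets greedily colours any
`β c² log c` vertices with `c` colours when `β < 1/4` and `c` is large (`colorableOn_of_card_le`);
this is the source of the constant `1/4`.

A long cycle is found by strong induction on the number of colours (`exists_hasCycleIn_min`). At the
price of boundedly many colours, pass to a subgraph that fewer than `ℓ` vertices cannot separate
(`exists_inseparableOn_not_colorableOn`). If its longest cycle, of length `n`, is too short, then a
fraction `t < 1` of the colours suffices for the vertices of that cycle; the rest still needs a
positive fraction of the colours, and by induction contains a cycle whose length is at least a fixed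
fraction of the target. Menger's theorem joins the two cycles by `ℓ` disjoint paths, two of which
end close together on the longest cycle. Rerouting there through the other cycle
(`InseparableOn.exists_long_cycle`) loses at most `n / (ℓ - 1)` and gains half of the other cycle,
which contradicts maximality once `ℓ` is large.

For consecutive lengths, take a breadth-first tree. Some level needs half of the colours. Split a
connected piece of that level according to the branches at the deepest common ancestor: one of two
parts again needs half of the colours. A path inside the level leads from the other part to a long
cycle in this part; after following the cycle for `i` steps, one returns through the tree by a path
whose length does not depend on `i`. So a cycle of length `n` yields `n` consecutive lengths, and
keeping a quarter of the colours turns `1/4` into `1/4 · (1/4)² = 1/64`. The de Bruijn–Erdős theorem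
reduces everything to finite graphs. -/

/-! ### Analysis of Shearer's function. -/

/-- Shearer's function, as an integral. -/
noncomputable def shearer (d : ℝ) : ℝ := ∫ t in (0 : ℝ)..1, (1 - t) / (1 + (d - 1) * t)

/-- The derivative of Shearer's function. -/
noncomputable def shearerSlope (d : ℝ) : ℝ :=
  ∫ t in (0 : ℝ)..1, -((1 - t) * t / (1 + (d - 1) * t) ^ 2)

theorem shearer_denom_pos {d t : ℝ} (hd : 0 < d) (h0 : 0 ≤ t) (h1 : t ≤ 1) :
    0 < 1 + (d - 1) * t := by
  rcases eq_or_lt_of_le h0 with rfl | h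
  · simp
  · nlinarith [mul_pos hd h]

theorem intervalIntegrable_shearer {d : ℝ} (hd : 0 < d) :
    IntervalIntegrable (fun t : ℝ => (1 - t) / (1 + (d - 1) * t)) MeasureTheory.volume 0 1 := by
  apply ContinuousOn.intervalIntegrable
  rw [Set.uIcc_of_le zero_le_one]
  apply ContinuousOn.div (by fun_prop) (by fun_prop)
  intro t ht
  exact (shearer_denom_pos hd ht.1 ht.2).ne'

theorem intervalIntegrable_shearerSlope {d : ℝ} (hd : 0 < d) :
    IntervalIntegrable (fun t : ℝ => -((1 - t) * t / (1 + (d - 1) * t) ^ 2))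
      MeasureTheory.volume 0 1 := by
  apply ContinuousOn.intervalIntegrable
  rw [Set.uIcc_of_le zero_le_one]
  apply ContinuousOn.neg
  apply ContinuousOn.div (by fun_prop) (by fun_prop)
  intro t ht
  exact pow_ne_zero _ (shearer_denom_pos hd ht.1 ht.2).ne'

theorem shearer_zero : shearer 0 = 1 := by
  have : shearer 0 = ∫ t in (0 : ℝ)..1, (1 : ℝ) := by
    unfold shearer
    -- At `t = 1` the integrand is `0 / 0 = 0`, hence the comparison on the open interval.
    apply intervalIntegral.integral_congr_Ioo_of_le zero_le_one
    intro t ht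
    have : 1 - t ≠ 0 := by linarith [ht.2]
    simp only
    rw [show 1 + (0 - 1) * t = 1 - t by ring]
    exact div_self this
  simpa using this

theorem shearerSlope_nonpos {d : ℝ} (hd : 0 < d) : shearerSlope d ≤ 0 := by
  have : shearerSlope d ≤ ∫ t in (0 : ℝ)..1, (0 : ℝ) := by
    apply intervalIntegral.integral_mono_on zero_le_one (intervalIntegrable_shearerSlope hd)
      (by simp)
    intro t ht
    have := shearer_denom_pos hd ht.1 ht.2
    have h1 : 0 ≤ 1 - t := by linarith [ht.2]
    have h0 := ht.1
    simp only [Left.neg_nonpos_iff]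
    positivity
  simpa using this

/-- The integrand is convex in `d`: with `u`, `v` the denominators at `d` and `x`, `1 / v` lies
above the tangent `1 / u - (v - u) / u²`. The value `x = 0` is needed for edgeless remainders in
Shearer's induction. -/
theorem shearer_tangent {d x : ℝ} (hd : 0 < d) (hx : 0 ≤ x) :
    shearer d + shearerSlope d * (x - d) ≤ shearer x := by
  have key : ∀ t ∈ Set.Ioo (0 : ℝ) 1, (1 - t) / (1 + (d - 1) * t) +
      -((1 - t) * t / (1 + (d - 1) * t) ^ 2) * (x - d) ≤ (1 - t) / (1 + (x - 1) * t) := by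
    intro t ht
    have hu := shearer_denom_pos hd ht.1.le ht.2.le
    have hv : 0 < 1 + (x - 1) * t := by nlinarith [ht.1, ht.2, mul_nonneg hx ht.1.le]
    have h1 : 0 < 1 - t := by linarith [ht.2]
    set u := 1 + (d - 1) * t with hu'
    set v := 1 + (x - 1) * t with hv'
    have : t * (x - d) = v - u := by rw [hu', hv']; ring
    have e : (1 - t) / u + -((1 - t) * t / u ^ 2) * (x - d)
        = (1 - t) * (1 / u - (v - u) / u ^ 2) := by
      rw [← this]; field_simp; ring
    rw [e, div_eq_mul_one_div (1 - t) v]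
    apply mul_le_mul_of_nonneg_left _ h1.le
    rw [← sub_nonneg]
    have : 1 / v - (1 / u - (v - u) / u ^ 2) = (u - v) ^ 2 / (u ^ 2 * v) := by
      field_simp; ring
    rw [this]; positivity
  have hint : shearer d + shearerSlope d * (x - d) =
      ∫ t in (0 : ℝ)..1, ((1 - t) / (1 + (d - 1) * t) +
      -((1 - t) * t / (1 + (d - 1) * t) ^ 2) * (x - d)) := by
    rw [intervalIntegral.integral_add (intervalIntegrable_shearer hd)
      ((intervalIntegrable_shearerSlope hd).mul_const _), intervalIntegral.integral_mul_const]
    rfl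
  have hi := (intervalIntegrable_shearer hd).add
    ((intervalIntegrable_shearerSlope hd).mul_const (x - d))
  rcases eq_or_lt_of_le hx with rfl | hx
  · rw [shearer_zero, hint]
    have : ∫ t in (0 : ℝ)..1, (1 : ℝ) = 1 := by simp
    refine le_of_le_of_eq ?_ this
    refine intervalIntegral.integral_mono_on_of_le_Ioo zero_le_one hi (by simp) ?_
    intro t ht
    have := key t ht
    have h1 : 1 - t ≠ 0 := by linarith [ht.2]
    rwa [show (1 : ℝ) + (0 - 1) * t = 1 - t by ring, div_self h1] at this
  · rw [hint]
    exact intervalIntegral.integral_mono_on_of_le_Ioo zero_le_one hi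
      (intervalIntegrable_shearer hx) key

theorem shearer_antitone {d x : ℝ} (hx : 0 ≤ x) (hxd : x ≤ d) (hd : 0 < d) :
    shearer d ≤ shearer x := by
  have := shearer_tangent hd hx
  nlinarith [mul_nonneg_of_nonpos_of_nonpos (shearerSlope_nonpos hd) (sub_nonpos.2 hxd)]

/-- The combined integrand is the derivative of `-(1 - t)² / (1 + (d - 1) t)`. This identity makes
the averaging in `exists_isIndepSet_shearer` balance exactly. -/
theorem shearer_ode {d : ℝ} (hd : 0 < d) :
    (d + 1) * shearer d - (d - d ^ 2) * shearerSlope d = 1 := by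
  have hint : (d + 1) * shearer d - (d - d ^ 2) * shearerSlope d =
      ∫ t in (0 : ℝ)..1, ((d + 1) * ((1 - t) / (1 + (d - 1) * t)) -
        (d - d ^ 2) * (-((1 - t) * t / (1 + (d - 1) * t) ^ 2))) := by
    rw [intervalIntegral.integral_sub ((intervalIntegrable_shearer hd).const_mul _)
      ((intervalIntegrable_shearerSlope hd).const_mul _), intervalIntegral.integral_const_mul,
      intervalIntegral.integral_const_mul]
    rfl
  rw [hint, intervalIntegral.integral_eq_sub_of_hasDerivAt
    (f := fun t => -((1 - t) ^ 2 / (1 + (d - 1) * t)))]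
  · simp
  · intro t ht
    rw [Set.uIcc_of_le zero_le_one] at ht
    have hu := shearer_denom_pos hd ht.1 ht.2
    have h1 : HasDerivAt (fun t : ℝ => (1 - t) ^ 2) (2 * (1 - t) * (-1)) t := by
      refine (((hasDerivAt_id t).const_sub 1).fun_pow 2).congr_deriv (by simp)
    have h2 : HasDerivAt (fun t : ℝ => 1 + (d - 1) * t) (d - 1) t := by
      simpa using ((hasDerivAt_id t).const_mul (d - 1)).const_add 1
    refine (h1.fun_div h2 hu.ne').fun_neg.congr_deriv ?_
    have := hu.ne'
    field_simp
    ring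
  · exact ((intervalIntegrable_shearer hd).const_mul _).sub
      ((intervalIntegrable_shearerSlope hd).const_mul _)

/-- The integrand is at least `1 / (1 + d t) - 1 / d`, whose integral is `(log (1 + d) - 1) / d`. -/
theorem log_sub_one_div_le_shearer {d : ℝ} (hd : 1 ≤ d) :
    (Real.log d - 1) / d ≤ shearer d := by
  have hd0 : 0 < d := by linarith
  have hcont : IntervalIntegrable (fun t : ℝ => 1 / (1 + d * t) - 1 / d)
      MeasureTheory.volume 0 1 := by
    apply ContinuousOn.intervalIntegrable
    rw [Set.uIcc_of_le zero_le_one]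
    apply ContinuousOn.sub _ (by fun_prop)
    apply ContinuousOn.div (by fun_prop) (by fun_prop)
    intro t ht
    have := mul_nonneg hd0.le ht.1
    positivity
  have h1 : ∫ t in (0 : ℝ)..1, (1 / (1 + d * t) - 1 / d) = Real.log (1 + d) / d - 1 / d := by
    rw [intervalIntegral.integral_eq_sub_of_hasDerivAt
      (f := fun t => Real.log (1 + d * t) / d - 1 / d * t) _ hcont]
    · simp
    · intro t ht
      rw [Set.uIcc_of_le zero_le_one] at ht
      have hu : 0 < 1 + d * t := by nlinarith [ht.1]
      have h2 : HasDerivAt (fun t : ℝ => 1 + d * t) d t := by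
        simpa using ((hasDerivAt_id t).const_mul d).const_add 1
      refine (((h2.log hu.ne').div_const d).fun_sub
        ((hasDerivAt_id t).const_mul (1 / d))).congr_deriv ?_
      field_simp
  have h2 : ∫ t in (0 : ℝ)..1, (1 / (1 + d * t) - 1 / d) ≤ shearer d := by
    apply intervalIntegral.integral_mono_on zero_le_one hcont (intervalIntegrable_shearer hd0)
    intro t ht
    have hu := shearer_denom_pos hd0 ht.1 ht.2
    have hv : 0 < 1 + d * t := by nlinarith [ht.1]
    have h1t : 0 ≤ 1 - t := by linarith [ht.2]
    have h3 : (1 - t) / (1 + d * t) ≤ (1 - t) / (1 + (d - 1) * t) := by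
      apply div_le_div_of_nonneg_left h1t hu
      nlinarith [ht.1]
    refine le_trans ?_ h3
    have : (1 - t) / (1 + d * t) - (1 / (1 + d * t) - 1 / d) = (1 / d) / (1 + d * t) := by
      have := hv.ne'
      rw [eq_div_iff this, sub_mul, sub_mul, div_mul_cancel₀ _ this, div_mul_cancel₀ _ this]
      field_simp; ring
    have h4 : 0 ≤ (1 / d) / (1 + d * t) := by positivity
    linarith
  have h3 : Real.log d ≤ Real.log (1 + d) := Real.log_le_log hd0 (by linarith)
  calc (Real.log d - 1) / d ≤ (Real.log (1 + d) - 1) / d := by gcongr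
    _ = _ := by rw [h1]; ring
    _ ≤ _ := h2

/-- Absorbs shifts and rounding of the number of colours into a small loss in the leading constant.
-/
theorem exists_mul_sq_mul_log_le (s : ℝ) {t γ : ℝ} (ht : 0 < t) (hγ0 : 0 < γ) (hγ : γ < t ^ 2) :
    ∃ K : ℕ, ∀ k : ℕ, K ≤ k → ∀ x : ℝ, t * k - s ≤ x →
      γ * k ^ 2 * Real.log k ≤ x ^ 2 * Real.log x := by
  have hs0 : 0 < √γ := Real.sqrt_pos.2 hγ0
  have hs1 : √γ < t := (Real.sqrt_lt' ht).2 hγ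
  -- The gap `t - t'` pays for the shift `s`, and the factor `ρ < 1` pays for `log t'`.
  obtain ⟨t', ht'0, ht't, hγt'⟩ : ∃ t' : ℝ, 0 < t' ∧ t' < t ∧ γ < t' ^ 2 :=
    ⟨(√γ + t) / 2, by linarith, by linarith, (Real.sqrt_lt' (by linarith)).1 (by linarith)⟩
  obtain ⟨ρ, hργ, hρ0, hρ1⟩ : ∃ ρ : ℝ, γ = t' ^ 2 * ρ ∧ 0 < ρ ∧ ρ < 1 :=
    ⟨γ / t' ^ 2, by field_simp, by positivity, (div_lt_one (by positivity)).2 hγt'⟩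
  have hcast := tendsto_natCast_atTop_atTop (R := ℝ)
  have e1 := hcast.eventually_ge_atTop (s / (t - t'))
  have e2 := (Real.tendsto_log_atTop.comp hcast).eventually_ge_atTop (-Real.log t' / (1 - ρ))
  have e3 := hcast.eventually_ge_atTop (1 / t')
  have e4 := hcast.eventually_ge_atTop 1
  obtain ⟨K, hK⟩ := Filter.eventually_atTop.1 (e1.and (e2.and (e3.and e4)))
  refine ⟨K, fun k hk x hx => ?_⟩
  obtain ⟨h1, h2, h3, h4⟩ := hK k hk
  simp only [Function.comp_apply] at h2
  rw [div_le_iff₀ (by linarith)] at h1 h2 h3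
  have hk0 : (0 : ℝ) < k := by linarith
  have hx' : t' * k ≤ x := by linarith
  have hlog : ρ * Real.log k ≤ Real.log x := by
    have : Real.log (t' * k) ≤ Real.log x := Real.log_le_log (by positivity) hx'
    rw [Real.log_mul ht'0.ne' hk0.ne'] at this
    linarith
  have hlogk : 0 ≤ Real.log k := Real.log_nonneg h4
  calc γ * k ^ 2 * Real.log k = (t' * k) ^ 2 * (ρ * Real.log k) := by rw [hργ]; ring
    _ ≤ x ^ 2 * Real.log x := by gcongr

/-! ### Shearer's theorem on independent sets. -/

namespace SimpleGraph

open Finset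

variable {V : Type*}

open Classical in
/-- The number of neighbours of `v` in `U`. -/
noncomputable def degOn (G : SimpleGraph V) (U : Finset V) (v : V) : ℕ := #{u ∈ U | G.Adj v u}

theorem not_adj_of_common_neighbor {G : SimpleGraph V} (hG : G.CliqueFree 3) {a b c : V}
    (hab : G.Adj a b) (hac : G.Adj a c) : ¬ G.Adj b c := by
  classical
  intro hbc
  exact hG {a, b, c} (is3Clique_triple_iff.2 ⟨hab, hac, hbc⟩)

theorem sum_sum_degOn (G : SimpleGraph V) (U : Finset V) [DecidableRel G.Adj] :
    ∑ p ∈ U, ∑ q ∈ U with G.Adj p q, (G.degOn U q : ℝ) = ∑ q ∈ U, (G.degOn U q : ℝ) ^ 2 := by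
  classical
  simp_rw [sum_filter]
  rw [sum_comm]
  refine sum_congr rfl fun q _ => ?_
  rw [← sum_filter, sum_const, nsmul_eq_mul, sq]
  congr 2
  unfold degOn
  congr 1
  ext x
  simp [G.adj_comm]

-- The neighbours of `p` are pairwise non-adjacent, so the edges lost on deleting `p` and its
-- neighbours are counted once by the degrees of these neighbours, and each lost edge counts twice
-- in the degree sum.
open Classical in
theorem sum_degOn_sdiff_le {G : SimpleGraph V} (hG : G.CliqueFree 3) (U : Finset V) {p : V}
    (hp : p ∈ U) :
    ∑ u ∈ U \ insert p {q ∈ U | G.Adj p q}, G.degOn (U \ insert p {q ∈ U | G.Adj p q}) u +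
      2 * ∑ q ∈ U with G.Adj p q, G.degOn U q ≤ ∑ u ∈ U, G.degOn U u := by
  set N := {q ∈ U | G.Adj p q} with hN
  set W := U \ insert p N with hW
  have hpN : p ∉ N := by simp [hN]
  have hsub : insert p N ⊆ U := insert_subset hp (filter_subset _ _)
  have hsplit : ∑ u ∈ U, G.degOn U u = ∑ u ∈ W, G.degOn U u + (#N + ∑ q ∈ N, G.degOn U q) := by
    rw [← sum_sdiff hsub, sum_insert hpN]
    rfl
  have h1 : ∀ u ∈ W, G.degOn W u + #{q ∈ N | G.Adj u q} ≤ G.degOn U u := by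
    intro u _
    unfold degOn
    rw [← card_union_of_disjoint]
    · apply card_le_card
      intro x hx
      simp only [mem_union, mem_filter, hW, mem_sdiff, hN] at hx ⊢
      tauto
    · rw [Finset.disjoint_left]
      intro x hx hx'
      simp only [mem_filter, hW, mem_sdiff, mem_insert] at hx hx'
      tauto
  have h2 : ∑ u ∈ W, #{q ∈ N | G.Adj u q} = ∑ q ∈ N, #{u ∈ W | G.Adj q u} := by
    simp_rw [card_filter]
    rw [sum_comm]
    simp_rw [G.adj_comm]
  have h3 : ∀ q ∈ N, G.degOn U q ≤ #{u ∈ W | G.Adj q u} + 1 := by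
    intro q hq
    unfold degOn
    refine le_trans (card_le_card ?_) (card_insert_le p _)
    intro x hx
    simp only [mem_filter, mem_insert, hW, mem_sdiff, hN] at hx hq ⊢
    by_cases hxp : x = p
    · exact Or.inl hxp
    · refine Or.inr ⟨⟨hx.1, ?_⟩, hx.2⟩
      rintro (h | h)
      · exact hxp h
      · exact not_adj_of_common_neighbor hG hq.2 h.2 hx.2
  have h4 := sum_le_sum h1
  have h5 := sum_le_sum h3
  rw [sum_add_distrib] at h4 h5
  rw [sum_const, smul_eq_mul, mul_one] at h5
  omega

open Classical in
/-- Shearer's bound on the independence number of triangle-free graphs. -/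
theorem exists_isIndepSet_shearer {G : SimpleGraph V} (hG : G.CliqueFree 3) (U : Finset V) :
    ∃ I ⊆ U, G.IsIndepSet (I : Set V) ∧
      (#U : ℝ) * shearer ((∑ u ∈ U, (G.degOn U u : ℝ)) / #U) ≤ #I := by
  induction U using Finset.strongInduction with
  | H U ih =>
  obtain ⟨n, hn⟩ : ∃ n : ℝ, n = #U := ⟨_, rfl⟩
  obtain ⟨E, hE⟩ : ∃ E : ℝ, E = ∑ u ∈ U, (G.degOn U u : ℝ) := ⟨_, rfl⟩
  rw [← hn, ← hE]
  have hE0 : 0 ≤ E := by rw [hE]; positivity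
  rcases eq_or_lt_of_le hE0 with hE0 | hE0
  · refine ⟨U, Subset.rfl, ?_, ?_⟩
    · have hz := (sum_eq_zero_iff_of_nonneg (fun i _ => by positivity)).1 (hE0.trans hE).symm
      intro a ha b hb _ hab
      have := hz a ha
      rw [Nat.cast_eq_zero, degOn, card_eq_zero, filter_eq_empty_iff] at this
      exact this hb hab
    · rw [← hE0, zero_div, shearer_zero, mul_one, hn]
  have hn0 : 0 < n := by
    rw [hn, Nat.cast_pos, card_pos, nonempty_iff_ne_empty]
    rintro rfl
    simp [hE] at hE0
  obtain ⟨d, hd⟩ : ∃ d : ℝ, d = E / n := ⟨_, rfl⟩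
  rw [← hd]
  have hEd : E = n * d := by rw [hd]; field_simp
  have hd0 : 0 < d := by rw [hd]; positivity
  have hD := shearerSlope_nonpos hd0
  have hode := shearer_ode hd0
  have htan := fun x (hx : 0 ≤ x) => shearer_tangent hd0 (x := x) hx
  generalize shearer d = F at *
  generalize shearerSlope d = D at *
  -- For each `p` the right side is one plus a tangent bound at `d` for what remains after deleting
  -- `p` and its neighbours. Its average over `p` is at least `n * F`, by Cauchy–Schwarz, `D ≤ 0`
  -- and the differential equation.
  obtain ⟨p, hpU, hp⟩ : ∃ p ∈ U, n * F ≤ 1 + (n - 1 - G.degOn U p) * F +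
      (E - 2 * ∑ q ∈ U with G.Adj p q, (G.degOn U q : ℝ) - (n - 1 - G.degOn U p) * d) * D := by
    apply exists_le_of_sum_le (card_pos.1 (by rw [hn] at hn0; exact_mod_cast hn0))
    have hsq : E ^ 2 ≤ n * ∑ q ∈ U, (G.degOn U q : ℝ) ^ 2 := by
      rw [hE, hn]
      exact sq_sum_le_card_mul_sum_sq
    set Q := ∑ q ∈ U, (G.degOn U q : ℝ) ^ 2 with hQ
    have hrhs : ∑ p ∈ U, (1 + (n - 1 - G.degOn U p) * F +
        (E - 2 * ∑ q ∈ U with G.Adj p q, (G.degOn U q : ℝ) - (n - 1 - G.degOn U p) * d) * D) =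
        n + (n * (n - 1) - E) * F + (n * E - 2 * Q - (n * (n - 1) - E) * d) * D := by
      simp only [sum_add_distrib, sum_sub_distrib, ← sum_mul, ← mul_sum, sum_sum_degOn]
      simp only [sum_const, nsmul_eq_mul, ← hn, ← hE, ← hQ]
      ring
    rw [hrhs, sum_const, nsmul_eq_mul, ← hn]
    have hQd : n * d ^ 2 ≤ Q := by
      have : n * (n * d ^ 2) ≤ n * Q := by rw [hEd] at hsq; linarith
      exact le_of_mul_le_mul_left this hn0
    have h1 : (n * E - 2 * (n * d ^ 2) - (n * (n - 1) - E) * d) * D ≤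
        (n * E - 2 * Q - (n * (n - 1) - E) * d) * D :=
      mul_le_mul_of_nonpos_right (by linarith) hD
    refine le_trans (le_of_eq ?_) (add_le_add_right h1 _)
    rw [hEd]
    linear_combination n * hode
  set N := {q ∈ U | G.Adj p q} with hN
  have hsub : insert p N ⊆ U := insert_subset hpU (filter_subset _ _)
  have hpN : p ∉ N := by simp [hN]
  have hcard : (#(U \ insert p N) : ℝ) = n - 1 - G.degOn U p := by
    rw [cast_card_sdiff hsub, card_insert_of_notMem hpN]
    simp only [degOn, ← hN, ← hn]
    push_cast
    ring
  obtain ⟨I, hIU, hI, hcI⟩ := ih (U \ insert p N) (sdiff_ssubset hsub ⟨p, by simp⟩)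
  have hpI : p ∉ I := fun h => by simpa using hIU h
  refine ⟨insert p I, insert_subset hpU (hIU.trans sdiff_subset), ?_, ?_⟩
  · have hpadj : ∀ b ∈ I, ¬ G.Adj p b := by
      intro b hb h
      have := hIU hb
      simp only [hN, mem_sdiff, mem_insert, mem_filter] at this
      tauto
    intro a ha b hb hab hadj
    simp only [coe_insert, Set.mem_insert_iff, mem_coe] at ha hb
    rcases ha with rfl | ha <;> rcases hb with rfl | hb
    · exact hab rfl
    · exact hpadj b hb hadj
    · exact hpadj a ha hadj.symm
    · exact hI ha hb hab hadj
  · rw [card_insert_of_notMem hpI]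
    push_cast
    have hE' : ∑ u ∈ U \ insert p N, (G.degOn (U \ insert p N) u : ℝ) ≤
        E - 2 * ∑ q ∈ U with G.Adj p q, (G.degOn U q : ℝ) := by
      have := sum_degOn_sdiff_le hG U hpU
      rw [le_sub_iff_add_le]
      rw [hE]
      exact_mod_cast this
    set E' := ∑ u ∈ U \ insert p N, (G.degOn (U \ insert p N) u : ℝ)
    have hlow : (n - 1 - G.degOn U p) * F + (E' - (n - 1 - G.degOn U p) * d) * D ≤ #I := by
      refine le_trans ?_ hcI
      rw [← hcard]
      rcases (U \ insert p N).eq_empty_or_nonempty with h | h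
      · have : E' = 0 := by simp only [E', h, sum_empty]
        have hz : (#(U \ insert p N) : ℝ) = 0 := by rw [h, card_empty, Nat.cast_zero]
        rw [hz, this]
        simp only [zero_mul, sub_zero, add_zero, le_refl]
      · have hm : (0 : ℝ) < #(U \ insert p N) := by exact_mod_cast card_pos.2 h
        have := mul_le_mul_of_nonneg_left (htan _
          (div_nonneg (sum_nonneg fun _ _ => Nat.cast_nonneg _) hm.le : 0 ≤ E' / #(U \ insert p N))) hm.le
        refine le_trans (le_of_eq ?_) this
        have hm' := hm.ne'
        rw [mul_add, mul_left_comm, mul_sub, mul_div_cancel₀ _ hm']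
        ring
    have := mul_le_mul_of_nonpos_right
      (sub_le_sub_right hE' ((n - 1 - G.degOn U p) * d)) hD
    linarith

/-! ### Colourings of vertex sets, and colouring small triangle-free graphs. -/

/-- The subgraph of `G` induced by `s` has a proper colouring with colours below `n`. -/
def ColorableOn (G : SimpleGraph V) (s : Set V) (n : ℕ) : Prop :=
  ∃ f : V → ℕ, (∀ v ∈ s, f v < n) ∧ ∀ u ∈ s, ∀ v ∈ s, G.Adj u v → f u ≠ f v

theorem colorableOn_iff_induce {G : SimpleGraph V} {s : Set V} {n : ℕ} :
    G.ColorableOn s n ↔ (G.induce s).Colorable n := by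
  classical
  rw [colorable_iff_exists_bdd_nat_coloring]
  constructor
  · rintro ⟨f, hf, hadj⟩
    exact ⟨Coloring.mk (fun v => f v) fun {u v} h => hadj u u.2 v v.2 h, fun v => hf v v.2⟩
  · rintro ⟨C, hC⟩
    refine ⟨fun v => if h : v ∈ s then C ⟨v, h⟩ else 0, ?_, ?_⟩
    · intro v hv
      simpa [hv] using hC ⟨v, hv⟩
    · intro u hu v hv h
      simpa [hu, hv] using C.valid (v := ⟨u, hu⟩) (w := ⟨v, hv⟩) h

theorem colorableOn_univ {G : SimpleGraph V} {n : ℕ} :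
    G.ColorableOn Set.univ n ↔ G.Colorable n := by
  rw [colorable_iff_exists_bdd_nat_coloring]
  constructor
  · rintro ⟨f, hf, hadj⟩
    exact ⟨Coloring.mk f fun {u v} h => hadj u trivial v trivial h, fun v => hf v trivial⟩
  · rintro ⟨C, hC⟩
    exact ⟨C, fun v _ => hC v, fun u _ v _ h => C.valid h⟩

theorem ColorableOn.mono {G : SimpleGraph V} {s t : Set V} {m n : ℕ} (hst : s ⊆ t) (hmn : m ≤ n)
    (h : G.ColorableOn t m) : G.ColorableOn s n := by
  obtain ⟨f, hf, hadj⟩ := h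
  exact ⟨f, fun v hv => (hf v (hst hv)).trans_le hmn,
    fun u hu v hv => hadj u (hst hu) v (hst hv)⟩

theorem ColorableOn.union {G : SimpleGraph V} {s t : Set V} {m n : ℕ} (hs : G.ColorableOn s m)
    (ht : G.ColorableOn t n) : G.ColorableOn (s ∪ t) (m + n) := by
  classical
  obtain ⟨f, hf, hfadj⟩ := hs
  obtain ⟨g, hg, hgadj⟩ := ht
  refine ⟨fun v => if v ∈ s then f v else m + g v, ?_, ?_⟩
  · intro v hv
    by_cases h : v ∈ s
    · simpa [h] using (hf v h).trans_le (Nat.le_add_right _ _)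
    · simpa [h] using hg v (hv.resolve_left h)
  · intro u hu v hv huv
    by_cases hus : u ∈ s <;> by_cases hvs : v ∈ s <;> simp only [hus, hvs, if_true, if_false]
    · exact hfadj u hus v hvs huv
    · have := hf u hus
      omega
    · have := hf v hvs
      omega
    · have := hgadj u (hu.resolve_left hus) v (hv.resolve_left hvs) huv
      omega

theorem IsIndepSet.colorableOn {G : SimpleGraph V} {s : Set V} (hs : G.IsIndepSet s) :
    G.ColorableOn s 1 :=
  ⟨fun _ => 0, fun _ _ => Nat.one_pos, fun _ hu _ hv h => absurd h (hs hu hv h.ne)⟩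

theorem colorableOn_card (G : SimpleGraph V) (U : Finset V) : G.ColorableOn U #U := by
  rw [colorableOn_iff_induce]
  simpa using (G.induce (U : Set V)).colorable_of_fintype

/-- Neighbourhoods are independent, so no degree exceeds the size of a largest independent set;
`shearer` is decreasing. -/
theorem exists_isIndepSet_card_mul_shearer_le {G : SimpleGraph V} (hG : G.CliqueFree 3)
    {U : Finset V} (hU : U.Nonempty) :
    ∃ I ⊆ U, G.IsIndepSet (I : Set V) ∧ 0 < #I ∧ (#U : ℝ) * shearer #I ≤ #I := by
  classical
  obtain ⟨I, hI, hmax⟩ := exists_max_image (U.powerset.filter fun I : Finset V => G.IsIndepSet (I : Set V)) card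
    ⟨∅, by simp⟩
  simp only [mem_filter, mem_powerset, and_imp] at hI hmax
  have hpos : 0 < #I := by
    obtain ⟨u, hu⟩ := hU
    have := hmax {u} (by simpa using hu) (by simp)
    simpa using this
  refine ⟨I, hI.1, hI.2, hpos, ?_⟩
  obtain ⟨J, hJU, hJ, hcJ⟩ := exists_isIndepSet_shearer hG U
  have hJI : (#J : ℝ) ≤ #I := by exact_mod_cast hmax J hJU hJ
  refine le_trans ?_ (hcJ.trans hJI)
  have hUpos : (0 : ℝ) < #U := by exact_mod_cast card_pos.2 hU
  refine mul_le_mul_of_nonneg_left (shearer_antitone ?_ ?_ (by exact_mod_cast hpos)) hUpos.le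
  · exact div_nonneg (sum_nonneg fun _ _ => Nat.cast_nonneg _) hUpos.le
  · rw [div_le_iff₀ hUpos]
    have : ∀ u ∈ U, (G.degOn U u : ℝ) ≤ #I := by
      intro u _
      have := hmax {x ∈ U | G.Adj u x} (filter_subset _ _) (by
        intro a ha b hb _
        simp only [coe_filter, Set.mem_ofPred_eq] at ha hb
        exact not_adj_of_common_neighbor hG ha.2 hb.2)
      unfold degOn
      exact_mod_cast (by convert this : _ ≤ #I)
    refine (sum_le_sum this).trans (le_of_eq ?_)
    rw [sum_const, nsmul_eq_mul, mul_comm]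

/-- Triangle-free graphs on `n` vertices have independent sets of size about `√(n log n / 2)`. -/
theorem exists_isIndepSet_sq_ge {κ : ℝ} (hκ0 : 0 < κ) (hκ : κ < 1 / 2) :
    ∃ N : ℝ, 1 ≤ N ∧ ∀ {V : Type*} (G : SimpleGraph V), G.CliqueFree 3 → ∀ U : Finset V,
      N ≤ #U → ∃ I ⊆ U, G.IsIndepSet (I : Set V) ∧
        κ * (#U * Real.log #U) ≤ (#I : ℝ) ^ 2 := by
  -- This makes both `κ log n` and `(1/2 - κ) log n` at least one: the former gives `log y ≥ L / 2`
  -- below, the latter the final contradiction.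
  refine ⟨Real.exp (1 / κ + 1 / (1 / 2 - κ)), ?_, ?_⟩
  · have : 0 < 1 / 2 - κ := by linarith
    exact Real.one_le_exp (by positivity)
  intro V G hG U hU
  have hκ' : 0 < 1 / 2 - κ := by linarith
  have hn0 : (0 : ℝ) < #U := (Real.exp_pos _).trans_le hU
  have hUne : U.Nonempty := card_pos.1 (by exact_mod_cast hn0)
  have hlog : 1 / κ + 1 / (1 / 2 - κ) ≤ Real.log #U := (Real.le_log_iff_exp_le hn0).2 hU
  obtain ⟨I, hIU, hI, hpos, hle⟩ := exists_isIndepSet_card_mul_shearer_le hG hUne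
  refine ⟨I, hIU, hI, ?_⟩
  have hn1 : (1 : ℝ) ≤ #U := by exact_mod_cast card_pos.2 hUne
  generalize (#U : ℝ) = n at *
  have ha : (0 : ℝ) < #I := by exact_mod_cast hpos
  generalize (#I : ℝ) = a at *
  by_contra! hlt
  set L := Real.log n
  have p1 : 0 < 1 / κ := by positivity
  have p2 : 0 < 1 / (1 / 2 - κ) := by positivity
  have hκL : 1 ≤ κ * L := by
    have : κ * (1 / κ) ≤ κ * L := by gcongr; linarith
    rwa [mul_one_div_cancel hκ0.ne'] at this
  have hκL' : 1 ≤ (1 / 2 - κ) * L := by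
    have : (1 / 2 - κ) * (1 / (1 / 2 - κ)) ≤ (1 / 2 - κ) * L := by gcongr; linarith
    rwa [mul_one_div_cancel hκ'.ne'] at this
  have hy2 : n ≤ κ * (n * L) := by nlinarith
  set y := √(κ * (n * L)) with hy
  have hysq : y ^ 2 = κ * (n * L) := Real.sq_sqrt (by linarith)
  have hy1 : 1 ≤ y := Real.one_le_sqrt.2 (by linarith)
  have hay : a < y := Real.lt_sqrt_of_sq_lt hlt
  have hF : (Real.log y - 1) / y ≤ shearer a :=
    (log_sub_one_div_le_shearer hy1).trans (shearer_antitone ha.le hay.le (by linarith))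
  have hlogy : L / 2 ≤ Real.log y := by
    rw [hy, Real.log_sqrt (by linarith)]
    have := Real.log_le_log hn0 hy2
    linarith
  have h1 : n * ((Real.log y - 1) / y) < y := by
    calc _ ≤ n * shearer a := by gcongr
      _ ≤ a := hle
      _ < y := hay
  have hypos : 0 < y := by linarith
  rw [← mul_div_assoc, div_lt_iff₀ hypos, ← sq, hysq] at h1
  have h2 : n * (L / 2 - 1) ≤ n * (Real.log y - 1) := by gcongr
  have h3 : n * (L / 2 - 1) < n * (κ * L) := by linarith
  have := lt_of_mul_lt_mul_left h3 hn0.le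
  linarith

/-- Greedy colouring by large independent sets. -/
theorem exists_colorableOn_of_large_isIndepSet (G : SimpleGraph V) {γ m₀ : ℝ} {c₀ : ℕ}
    (hγ : 0 < γ)
    (hlarge : ∀ U : Finset V, U.Nonempty → m₀ ≤ #U →
      ∃ I ⊆ U, G.IsIndepSet (I : Set V) ∧ γ * √(#U) ≤ #I)
    (hsmall : ∀ U : Finset V, #U < m₀ → G.ColorableOn U c₀) (U : Finset V) :
    ∃ c : ℕ, G.ColorableOn U c ∧ (c : ℝ) ≤ 2 * √(#U) / γ + c₀ := by
  classical
  induction U using Finset.strongInduction with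
  | H U ih =>
  rcases lt_or_ge (#U : ℝ) m₀ with h | h
  · refine ⟨c₀, hsmall U h, ?_⟩
    have : 0 ≤ 2 * √(#U) / γ := by positivity
    linarith
  rcases U.eq_empty_or_nonempty with rfl | hne
  · refine ⟨0, by simpa using colorableOn_card G ∅, ?_⟩
    push_cast
    positivity
  obtain ⟨I, hIU, hI, hc⟩ := hlarge U hne h
  have hUpos : (0 : ℝ) < √(#U) := Real.sqrt_pos.2 (by exact_mod_cast card_pos.2 hne)
  have hIpos : (0 : ℝ) < #I := (mul_pos hγ hUpos).trans_le hc
  have hIne : I.Nonempty := card_pos.1 (by exact_mod_cast hIpos)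
  obtain ⟨c, hcol, hcle⟩ := ih (U \ I) (sdiff_ssubset hIU hIne)
  refine ⟨c + 1, ?_, ?_⟩
  · have := hcol.union hI.colorableOn
    rw [← coe_union, sdiff_union_of_subset hIU] at this
    exact this
  · have hsq : √(#U) ^ 2 = #U := Real.sq_sqrt (by positivity)
    have hIcard : (#I : ℝ) ≤ #U := by exact_mod_cast card_le_card hIU
    have hγU : γ ≤ √(#U) := by
      rw [← hsq, sq] at hIcard
      exact le_of_mul_le_mul_right (hc.trans hIcard) hUpos
    -- Each colour lowers the square root by `γ / 2`, whence the `2 √n / γ` colours; `γ ≤ √n` keeps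
    -- the right side nonnegative.
    have hs : √(#(U \ I)) ≤ √(#U) - γ / 2 := by
      rw [Real.sqrt_le_left (by linarith), cast_card_sdiff hIU]
      nlinarith [sq_nonneg γ]
    push_cast
    have : 2 * √(#(U \ I)) / γ ≤ 2 * √(#U) / γ - 1 := by
      rw [le_sub_iff_add_le, ← le_sub_iff_add_le, div_le_iff₀ hγ]
      have : (2 * √(#U) / γ - 1) * γ = 2 * √(#U) - γ := by field_simp
      linarith
    linarith

/-- A crude bound, used only for the vertices left over by the sharp greedy colouring. -/
theorem exists_colorableOn_two_sqrt :
    ∃ M : ℕ, ∀ {V : Type*} (G : SimpleGraph V), G.CliqueFree 3 → ∀ U : Finset V,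
      ∃ c : ℕ, G.ColorableOn U c ∧ (c : ℝ) ≤ 2 * √(#U) + M := by
  obtain ⟨N, hN1, hN⟩ := exists_isIndepSet_sq_ge (κ := 1 / 4) (by norm_num) (by norm_num)
  refine ⟨⌈max N (Real.exp 4)⌉₊, fun {V} G hG U => ?_⟩
  have hlarge : ∀ W : Finset V, W.Nonempty → max N (Real.exp 4) ≤ #W →
      ∃ I ⊆ W, G.IsIndepSet (I : Set V) ∧ 1 * √(#W) ≤ #I := by
    intro W hW hle
    obtain ⟨I, hI, hind, hsq⟩ := hN G hG W ((le_max_left _ _).trans hle)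
    refine ⟨I, hI, hind, ?_⟩
    have hpos : (0 : ℝ) < #W := by exact_mod_cast card_pos.2 hW
    have hlog : 4 ≤ Real.log #W :=
      (Real.le_log_iff_exp_le hpos).2 ((le_max_right _ _).trans hle)
    rw [one_mul, Real.sqrt_le_left (by positivity)]
    nlinarith
  have hsmall : ∀ W : Finset V, #W < max N (Real.exp 4) →
      G.ColorableOn W ⌈max N (Real.exp 4)⌉₊ := by
    intro W hW
    refine (colorableOn_card G W).mono subset_rfl ?_
    exact_mod_cast hW.le.trans (Nat.le_ceil _)
  obtain ⟨c, hc, hle⟩ := exists_colorableOn_of_large_isIndepSet G (γ := 1)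
    (m₀ := max N (Real.exp 4)) (c₀ := ⌈max N (Real.exp 4)⌉₊) one_pos hlarge hsmall U
  exact ⟨c, hc, by simpa using hle⟩

/-- Triangle-free graphs with at most `β c² log c` vertices are `c`-colourable, for `β < 1/4` and
large `c`. -/
theorem colorableOn_of_card_le {β : ℝ} (hβ0 : 0 < β) (hβ : β < 1 / 4) :
    ∃ K : ℕ, ∀ c : ℕ, K ≤ c → ∀ {V : Type*} (G : SimpleGraph V), G.CliqueFree 3 →
      ∀ U : Finset V, (#U : ℝ) ≤ β * c ^ 2 * Real.log c → G.ColorableOn U c := by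
  have hb1 : √β < 1 / 2 := by
    rw [Real.sqrt_lt' (by norm_num)]; norm_num; linarith
  have hb0 : 0 < √β := Real.sqrt_pos.2 hβ0
  -- The greedy phase will use at most `σ c` colours with `σ = 2 √β / s`; `s < 1` leaves room for
  -- lower-order losses in the logarithm.
  obtain ⟨s, hs0, hs1, hs2⟩ : ∃ s : ℝ, 0 < s ∧ s < 1 ∧ 2 * √β < s :=
    ⟨(1 + 2 * √β) / 2, by linarith, by linarith, by linarith⟩
  obtain ⟨σ, hσ, hσ0, hσ1⟩ : ∃ σ : ℝ, σ = 2 * √β / s ∧ 0 < σ ∧ σ < 1 :=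
    ⟨_, rfl, by positivity, (div_lt_one hs0).2 hs2⟩
  obtain ⟨N, hN1, hN⟩ := exists_isIndepSet_sq_ge (κ := s / 2) (by linarith) (by linarith)
  obtain ⟨M, hM⟩ := exists_colorableOn_two_sqrt
  have hcast := tendsto_natCast_atTop_atTop (R := ℝ)
  have hloglim : Filter.Tendsto (fun c : ℕ => Real.log c) Filter.atTop Filter.atTop :=
    Real.tendsto_log_atTop.comp hcast
  have e1 : ∀ᶠ c : ℕ in Filter.atTop, Real.log (Real.log c) ≤ (2 - 2 * s) * Real.log c := by
    have h := (Real.isLittleO_log_id_atTop.bound (show 0 < 2 - 2 * s by linarith))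
    filter_upwards [hloglim.eventually h, hloglim.eventually_ge_atTop 1] with c hc hc1
    have := (le_abs_self _).trans hc
    simpa [abs_of_nonneg (zero_le_one.trans hc1)] using this
  have e2 := hcast.eventually_ge_atTop N
  have e3 := hloglim.eventually_ge_atTop (max 1 ((4 / (1 - σ)) ^ 2))
  have e4 := hcast.eventually_ge_atTop (2 * (M + 1) / (1 - σ))
  have e5 := hcast.eventually_ge_atTop 1
  obtain ⟨K, hK⟩ := Filter.eventually_atTop.1 (e1.and (e2.and (e3.and (e4.and e5))))
  refine ⟨K, fun c hc {V} G hG U hU => ?_⟩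
  obtain ⟨h1, h2, h3, h4, h5⟩ := hK c hc
  have hc0 : (0 : ℝ) < c := by linarith
  set L := Real.log c with hL
  have hL1 : 1 ≤ L := (le_max_left _ _).trans h3
  have hL2 : (4 / (1 - σ)) ^ 2 ≤ L := (le_max_right _ _).trans h3
  have hL0 : 0 < L := by linarith
  have hLc : L ≤ c := (Real.log_le_sub_one_of_pos hc0).trans (by linarith)
  -- The greedy phase stops below `c² / L` vertices: above this threshold the logarithm of the
  -- number of vertices is at least `2 s L`, and below it `2 c / √L + M` colours suffice, which fits
  -- into the spare `(1 - σ) c`.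
  have hm₀ : c ≤ (c : ℝ) ^ 2 / L := by
    rw [le_div_iff₀ hL0]; nlinarith
  have hsqL : 0 < √L := Real.sqrt_pos.2 hL0
  have hlarge : ∀ W : Finset V, W.Nonempty → (c : ℝ) ^ 2 / L ≤ #W →
      ∃ I ⊆ W, G.IsIndepSet (I : Set V) ∧ s * √L * √(#W) ≤ #I := by
    intro W hW hle
    obtain ⟨I, hI, hind, hsq⟩ := hN G hG W (by linarith)
    refine ⟨I, hI, hind, ?_⟩
    have hpos : (0 : ℝ) < #W := by exact_mod_cast card_pos.2 hW
    have hlog : 2 * s * L ≤ Real.log #W := by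
      have : Real.log ((c : ℝ) ^ 2 / L) ≤ Real.log #W := Real.log_le_log (by positivity) hle
      rw [Real.log_div (by positivity) hL0.ne', Real.log_pow] at this
      push_cast at this
      linarith
    apply abs_le_of_sq_le_sq' _ (by positivity) |>.2
    refine le_trans (le_of_eq ?_) ((mul_le_mul_of_nonneg_left
      (mul_le_mul_of_nonneg_left hlog hpos.le) (by positivity)).trans hsq)
    rw [mul_pow, mul_pow, Real.sq_sqrt hL0.le, Real.sq_sqrt hpos.le]
    ring
  have hsmall : ∀ W : Finset V, #W < (c : ℝ) ^ 2 / L → G.ColorableOn W ⌈2 * c / √L + M⌉₊ := by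
    intro W hW
    obtain ⟨c₁, hc₁, hle⟩ := hM G hG W
    refine hc₁.mono subset_rfl ?_
    have : √(#W) ≤ c / √L := by
      rw [Real.sqrt_le_left (by positivity), div_pow, Real.sq_sqrt hL0.le]
      exact hW.le
    have h6 : (c₁ : ℝ) ≤ ⌈2 * c / √L + M⌉₊ := by
      refine le_trans ?_ (Nat.le_ceil _)
      have : 2 * (c : ℝ) / √L = 2 * (c / √L) := by ring
      linarith
    exact_mod_cast h6
  obtain ⟨c', hc', hle⟩ := exists_colorableOn_of_large_isIndepSet G (γ := s * √L)
    (m₀ := (c : ℝ) ^ 2 / L) (c₀ := ⌈2 * c / √L + M⌉₊) (by positivity) hlarge hsmall U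
  refine hc'.mono subset_rfl ?_
  have hU' : √(#U) ≤ √β * c * √L := by
    rw [Real.sqrt_le_left (by positivity), mul_pow, mul_pow, Real.sq_sqrt hβ0.le,
      Real.sq_sqrt hL0.le]
    exact hU
  have i1 : 2 * √(#U) / (s * √L) ≤ σ * c := by
    rw [div_le_iff₀ (by positivity), hσ]
    have : 2 * √β / s * c * (s * √L) = 2 * (√β * c * √L) := by field_simp
    linarith
  have i2 : (⌈2 * c / √L + M⌉₊ : ℝ) ≤ 2 * c / √L + M + 1 :=
    (Nat.ceil_lt_add_one (by positivity)).le
  have hσ' : 0 < 1 - σ := by linarith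
  have i3 : 4 / (1 - σ) ≤ √L := Real.le_sqrt_of_sq_le hL2
  have i4 : 2 * c / √L ≤ (1 - σ) * c / 2 := by
    rw [div_le_iff₀ hsqL]
    rw [div_le_iff₀ hσ'] at i3
    nlinarith
  have i5 : (M + 1 : ℝ) ≤ (1 - σ) * c / 2 := by
    rw [div_le_iff₀ hσ'] at h4
    linarith
  have : (c' : ℝ) ≤ c := by linarith
  exact_mod_cast this

/-! ### Highly connected subgraphs of large chromatic number. -/

/-- `G` restricted to `U` cannot be separated by fewer than `ℓ` vertices. -/
def InseparableOn (G : SimpleGraph V) (U : Finset V) (ℓ : ℕ) : Prop :=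
  ∀ A S B : Finset V, (∀ v, v ∈ U ↔ v ∈ A ∨ v ∈ S ∨ v ∈ B) → Disjoint A B → Disjoint A S →
    Disjoint S B → (∀ a ∈ A, ∀ b ∈ B, ¬ G.Adj a b) → #S < ℓ → A = ∅ ∨ B = ∅

/-- `f` is a proper colouring of `W ∪ X` with colours below `P` that extends `f₀` from `X` and
avoids the forbidden colours `F` on `W`. -/
structure IsColoringExtension (G : SimpleGraph V) (P : ℕ) (W X : Finset V) (f₀ : V → ℕ)
    (F : V → Finset ℕ) (f : V → ℕ) : Prop where
  lt : ∀ v, v ∈ W ∨ v ∈ X → f v < P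
  proper : ∀ u v, u ∈ W ∨ u ∈ X → v ∈ W ∨ v ∈ X → G.Adj u v → f u ≠ f v
  eq : ∀ x ∈ X, f x = f₀ x
  notMem : ∀ v ∈ W, f v ∉ F v

/-- The cost bound leaves at most `2ℓ` precoloured vertices and at most `2ℓ²` forbidden colours, so
`c` colours of the palette are untouched and can be used on all of `W`. -/
theorem exists_isColoringExtension_of_colorableOn [DecidableEq V] {G : SimpleGraph V} {ℓ c : ℕ}
    (hℓ : 0 < ℓ)
    {W X : Finset V} {f₀ : V → ℕ} {F : V → Finset ℕ} (hWX : Disjoint W X)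
    (hlt : ∀ x ∈ X, f₀ x < c + 2 * ℓ ^ 2 + 2 * ℓ)
    (hproper : ∀ u ∈ X, ∀ v ∈ X, G.Adj u v → f₀ u ≠ f₀ v)
    (hcost : ℓ * #X + ∑ v ∈ W, #(F v) ≤ 2 * ℓ ^ 2) (hcol : G.ColorableOn W c) :
    ∃ f, G.IsColoringExtension (c + 2 * ℓ ^ 2 + 2 * ℓ) W X f₀ F f := by
  obtain ⟨g, hg, hgp⟩ := hcol
  set P := c + 2 * ℓ ^ 2 + 2 * ℓ with hP
  set bad := X.image f₀ ∪ W.biUnion F with hbad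
  have hbadc : #bad ≤ 2 * ℓ ^ 2 + 2 * ℓ := by
    have h1 : #bad ≤ #X + ∑ v ∈ W, #(F v) :=
      (card_union_le _ _).trans (add_le_add card_image_le card_biUnion_le)
    have h2 : #X ≤ 2 * ℓ := by
      have : ℓ * #X ≤ ℓ * (2 * ℓ) := by
        rw [show ℓ * (2 * ℓ) = 2 * ℓ ^ 2 by ring]
        omega
      exact Nat.le_of_mul_le_mul_left this hℓ
    omega
  have hgood : c ≤ #(range P \ bad) := by
    have := le_card_sdiff bad (range P)
    rw [card_range] at this
    omega
  let e := orderEmbOfCardLe (range P \ bad) hgood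
  have he : ∀ i, e i ∈ range P \ bad := fun i => orderEmbOfCardLe_mem _ hgood i
  let h : V → ℕ := fun v => if hv : g v < c then e ⟨g v, hv⟩ else 0
  have hh : ∀ v ∈ W, h v ∈ range P \ bad := by
    intro v hv
    have := hg v hv
    simp only [h, this, dif_pos]
    exact he _
  have hX : ∀ x ∈ X, x ∉ W := fun x hx hw => (Finset.disjoint_left.1 hWX) hw hx
  have hXbad : ∀ x ∈ X, f₀ x ∈ bad := fun x hx => mem_union_left _ (mem_image_of_mem _ hx)
  refine ⟨fun v => if v ∈ W then h v else f₀ v, ?_, ?_, ?_, ?_⟩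
  · rintro v hv
    by_cases hvW : v ∈ W
    · simpa [hvW] using (mem_range.1 (mem_sdiff.1 (hh v hvW)).1)
    · simpa [hvW] using hlt v (hv.resolve_left hvW)
  · intro u v hu hv huv
    by_cases huW : u ∈ W <;> by_cases hvW : v ∈ W <;> simp only [huW, hvW, if_true, if_false]
    · have h1 := hg u huW
      have h2 := hg v hvW
      simp only [h, h1, h2, dif_pos]
      intro heq
      have := e.injective heq
      exact hgp u huW v hvW huv (by simpa using this)
    · intro heq
      exact (mem_sdiff.1 (hh u huW)).2 (heq ▸ hXbad v (hv.resolve_left hvW))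
    · intro heq
      exact (mem_sdiff.1 (hh v hvW)).2 (heq ▸ hXbad u (hu.resolve_left huW))
    · exact hproper u (hu.resolve_left huW) v (hv.resolve_left hvW) huv
  · intro x hx
    simp [hX x hx]
  · intro v hv hmem
    simp only [hv, if_true] at hmem
    exact (mem_sdiff.1 (hh v hv)).2 (mem_union_right _ (mem_biUnion.2 ⟨v, hv, hmem⟩))

/-- The statement is strengthened to precolourings with lists of forbidden colours so that induction
can cut along small separators. A precoloured vertex costs `ℓ`, a forbidden colour costs one, and
the budget `2ℓ²` is twice the cost of a separator. -/
theorem exists_isColoringExtension [DecidableEq V] {G : SimpleGraph V} {ℓ c : ℕ} (hℓ : 0 < ℓ)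
    {U₀ : Finset V} (hG : ∀ U ⊆ U₀, G.InseparableOn U ℓ → G.ColorableOn U c) (m : ℕ) :
    ∀ (k : ℕ) (W X : Finset V) (f₀ : V → ℕ) (F : V → Finset ℕ), W ∪ X ⊆ U₀ → #W = m → #X = k →
    Disjoint W X → (∀ x ∈ X, f₀ x < c + 2 * ℓ ^ 2 + 2 * ℓ) →
    (∀ u ∈ X, ∀ v ∈ X, G.Adj u v → f₀ u ≠ f₀ v) →
    ℓ * #X + ∑ v ∈ W, #(F v) ≤ 2 * ℓ ^ 2 →
    ∃ f, G.IsColoringExtension (c + 2 * ℓ ^ 2 + 2 * ℓ) W X f₀ F f := by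
  classical
  induction m using Nat.strong_induction_on with
  | _ m ihm =>
  intro k
  induction k with
  | zero => ?_
  | succ k ihk => ?_
  all_goals
    intro W X f₀ F hU₀ hW hX hWX hlt hproper hcost
    -- The main case, shared by both values of the inner induction.
    have hstep : (∀ x ∈ X, ℓ ≤ #{v ∈ W | G.Adj x v}) →
        ∃ f, G.IsColoringExtension (c + 2 * ℓ ^ 2 + 2 * ℓ) W X f₀ F f := ?_
  case zero.refine_2 =>
    exact hstep (by rw [card_eq_zero.1 hX]; simp)
  case succ.refine_2 =>
    by_cases hdeg : ∀ x ∈ X, ℓ ≤ #{v ∈ W | G.Adj x v}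
    · exact hstep hdeg
    push Not at hdeg
    obtain ⟨x, hx, hdx⟩ := hdeg
    have hXe : ∀ u, u ∈ X ↔ u = x ∨ u ∈ X.erase x := by
      intro u
      rw [mem_erase]
      by_cases h : u = x
      · simp [h, hx]
      · simp [h]
    have hxW : x ∉ W := fun h => (Finset.disjoint_left.1 hWX) h hx
    -- Forget `x` and forbid its colour at its neighbours in `W`: this saves `ℓ` and costs fewer
    -- than `ℓ`.
    obtain ⟨f, hf⟩ := ihk W (X.erase x) f₀
      (fun v => if G.Adj x v then insert (f₀ x) (F v) else F v)
      ((union_subset_union_right (erase_subset _ _)).trans hU₀) hW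
      (by rw [card_erase_of_mem hx, hX]; rfl) (hWX.mono_right (erase_subset _ _))
      (fun y hy => hlt y (mem_of_mem_erase hy))
      (fun u hu v hv => hproper u (mem_of_mem_erase hu) v (mem_of_mem_erase hv)) (by
        have h1 : ∑ v ∈ W, #(if G.Adj x v then insert (f₀ x) (F v) else F v) ≤
            ∑ v ∈ W, (#(F v) + if G.Adj x v then 1 else 0) := by
          apply sum_le_sum
          intro v _
          split_ifs
          · exact card_insert_le _ _
          · exact le_rfl
        rw [sum_add_distrib, ← card_filter] at h1
        have h2 : #(X.erase x) + 1 = #X := card_erase_add_one hx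
        have h3 : ℓ * #(X.erase x) + ℓ = ℓ * #X := by rw [← h2]; ring
        omega)
    refine ⟨Function.update f x (f₀ x), ?_, ?_, ?_, ?_⟩
    · intro v hv
      by_cases hvx : v = x
      · subst hvx; simpa using hlt v hx
      · rw [Function.update_of_ne hvx]
        exact hf.lt v (hv.imp_right fun h => mem_erase.2 ⟨hvx, h⟩)
    · have key : ∀ v, v ∈ W ∨ v ∈ X → G.Adj x v → f₀ x ≠ f v := by
        intro v hv hxv
        rcases hv with hv | hv
        · have := hf.notMem v hv
          rw [if_pos hxv, mem_insert] at this
          exact fun h => this (Or.inl h.symm)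
        · rw [hf.eq v (mem_erase.2 ⟨hxv.ne', hv⟩)]
          exact hproper x hx v hv hxv
      intro u v hu hv huv
      by_cases hux : u = x
      · subst hux
        rw [Function.update_self, Function.update_of_ne huv.ne']
        exact key v hv huv
      · by_cases hvx : v = x
        · subst hvx
          rw [Function.update_self, Function.update_of_ne hux]
          exact (key u hu huv.symm).symm
        · rw [Function.update_of_ne hux, Function.update_of_ne hvx]
          exact hf.proper u v (hu.imp_right fun h => mem_erase.2 ⟨hux, h⟩)
            (hv.imp_right fun h => mem_erase.2 ⟨hvx, h⟩) huv
    · intro y hy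
      by_cases hyx : y = x
      · subst hyx; simp
      · rw [Function.update_of_ne hyx]
        exact hf.eq y (mem_erase.2 ⟨hyx, hy⟩)
    · intro v hv
      have hvx : v ≠ x := fun h => hxW (h ▸ hv)
      rw [Function.update_of_ne hvx]
      have := hf.notMem v hv
      split_ifs at this
      · exact fun h => this (mem_insert_of_mem h)
      · exact this
  all_goals
    clear * - ihm hG hℓ hU₀ hW hWX hlt hproper hcost
    intro hdeg
    by_cases hsep : G.InseparableOn (W ∪ X) ℓ
    · exact exists_isColoringExtension_of_colorableOn hℓ hWX hlt hproper hcost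
        ((hG _ hU₀ hsep).mono (by simp) le_rfl)
    unfold InseparableOn at hsep
    push Not at hsep
    obtain ⟨A, S, B, hU, hAB, hAS, hSB, hadj, hS, hA, hB⟩ := hsep
    -- Let `B` be the side carrying at most half of the cost. Adding the separator to its
    -- precoloured vertices costs at most another `ℓ²`.
    wlog hle : ℓ * #(X ∩ B) + ∑ v ∈ W ∩ B, #(F v) ≤ ℓ ^ 2 generalizing A B
    · refine this B A (fun v => by rw [hU]; tauto) hAB.symm hSB.symm hAS.symm
        (fun a ha b hb h => hadj b hb a ha h.symm) hB hA ?_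
      have h1 : #(X ∩ A) + #(X ∩ B) ≤ #X := by
        rw [← card_union_of_disjoint (hAB.mono inter_subset_right inter_subset_right)]
        exact card_le_card (union_subset inter_subset_left inter_subset_left)
      have h2 : ∑ v ∈ W ∩ A, #(F v) + ∑ v ∈ W ∩ B, #(F v) ≤ ∑ v ∈ W, #(F v) := by
        rw [← sum_union (hAB.mono inter_subset_right inter_subset_right)]
        exact sum_le_sum_of_subset (union_subset inter_subset_left inter_subset_left)
      have h3 : ℓ * (#(X ∩ A) + #(X ∩ B)) ≤ ℓ * #X := Nat.mul_le_mul_left _ h1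
      rw [mul_add] at h3
      omega
    have hmem : ∀ v, v ∈ A ∨ v ∈ S ∨ v ∈ B ↔ v ∈ W ∨ v ∈ X := fun v => by
      rw [← hU, mem_union]
    -- Each side meets `W`, as a precoloured vertex has at least `ℓ > #S` neighbours in `W`. Hence
    -- both recursive calls have fewer vertices to colour.
    have hWne : ∀ A B : Finset V, (∀ v, v ∈ A ∨ v ∈ S ∨ v ∈ B ↔ v ∈ W ∨ v ∈ X) →
        (∀ a ∈ A, ∀ b ∈ B, ¬ G.Adj a b) → B.Nonempty → Disjoint S B → ∃ b ∈ B, b ∈ W := by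
      intro A B hmem hadj ⟨b, hb⟩ hSB
      by_contra! hno
      have hbX : b ∈ X := ((hmem b).1 (Or.inr (Or.inr hb))).resolve_left (hno b hb)
      have hsub : ({v ∈ W | G.Adj b v} : Finset V) ⊆ S := by
        intro v hv
        rw [mem_filter] at hv
        rcases (hmem v).2 (Or.inl hv.1) with h | h | h
        · exact absurd hv.2.symm (hadj v h b hb)
        · exact h
        · exact absurd hv.1 (hno v h)
      have := (hdeg b hbX).trans (card_le_card hsub)
      omega
    obtain ⟨b, hbB, hbW⟩ := hWne A B hmem hadj hB hSB
    obtain ⟨a, haA, haW⟩ := hWne B A (fun v => by rw [← hmem]; tauto)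
      (fun a ha b hb h => hadj b hb a ha h.symm) hA hAS.symm
    have haB : a ∉ B := Finset.disjoint_left.1 hAB haA
    obtain ⟨f₁, hf₁⟩ := ihm #(W \ B) (hW ▸ card_lt_card
      ⟨sdiff_subset, fun h => (mem_sdiff.1 (h hbW)).2 hbB⟩) _ (W \ B) X f₀ F
      ((union_subset_union_left sdiff_subset).trans hU₀) rfl rfl
      (hWX.mono_left sdiff_subset) hlt hproper
      (le_trans (Nat.add_le_add_left (sum_le_sum_of_subset sdiff_subset) _) hcost)
    have hX₂ : ∀ v, v ∈ (X ∩ B) ∪ S → v ∈ W \ B ∨ v ∈ X := by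
      intro v hv
      rcases mem_union.1 hv with h | h
      · exact Or.inr (mem_inter.1 h).1
      · rcases (hmem v).1 (Or.inr (Or.inl h)) with h' | h'
        · exact Or.inl (mem_sdiff.2 ⟨h', Finset.disjoint_left.1 hSB h⟩)
        · exact Or.inr h'
    obtain ⟨f₂, hf₂⟩ := ihm #(W ∩ B) (hW ▸ card_lt_card
      ⟨inter_subset_left, fun h => haB (mem_inter.1 (h haW)).2⟩) _ (W ∩ B) ((X ∩ B) ∪ S) f₁ F (by
        refine Subset.trans (fun v hv => ?_) hU₀
        rw [mem_union] at hv ⊢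
        rcases hv with h | h
        · exact Or.inl (mem_inter.1 h).1
        · exact (hX₂ v h).imp_left fun h => (mem_sdiff.1 h).1) rfl rfl (by
        rw [disjoint_union_right]
        exact ⟨hWX.mono inter_subset_left inter_subset_left, hSB.symm.mono_left inter_subset_right⟩)
      (fun v hv => hf₁.lt v (hX₂ v hv))
      (fun u hu v hv => hf₁.proper u v (hX₂ u hu) (hX₂ v hv)) (by
        have h1 := card_union_le (X ∩ B) S
        have h2 : ℓ * #((X ∩ B) ∪ S) ≤ ℓ * (#(X ∩ B) + #S) := Nat.mul_le_mul_left _ h1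
        have h3 : ℓ * #S ≤ ℓ * ℓ := Nat.mul_le_mul_left _ hS.le
        rw [mul_add] at h2
        rw [← sq] at h3
        omega)
    have hin : ∀ v, v ∈ W ∨ v ∈ X → v ∈ B → v ∈ W ∩ B ∨ v ∈ (X ∩ B) ∪ S := by
      intro v hv hvB
      simp only [mem_inter, mem_union]
      tauto
    have hout : ∀ v, v ∈ W ∨ v ∈ X → v ∉ B → v ∈ W \ B ∨ v ∈ X := by
      intro v hv hvB
      rw [mem_sdiff]
      tauto
    have hcross : ∀ u v, u ∈ W ∨ u ∈ X → v ∈ W ∨ v ∈ X → u ∈ B → v ∉ B → G.Adj u v →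
        f₂ u ≠ f₁ v := by
      intro u v hu hv huB hvB huv
      have hvS : v ∈ S := by
        rcases (hmem v).2 hv with h | h | h
        · exact absurd huv.symm (hadj v h u huB)
        · exact h
        · exact absurd h hvB
      have hvS' := mem_union_right (X ∩ B) hvS
      rw [← hf₂.eq v hvS']
      exact hf₂.proper u v (hin u hu huB) (Or.inr hvS') huv
    refine ⟨fun v => if v ∈ B then f₂ v else f₁ v, ?_, ?_, ?_, ?_⟩
    · intro v hv
      by_cases hvB : v ∈ B
      · simpa [hvB] using hf₂.lt v (hin v hv hvB)
      · simpa [hvB] using hf₁.lt v (hout v hv hvB)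
    · intro u v hu hv huv
      by_cases huB : u ∈ B <;> by_cases hvB : v ∈ B <;> simp only [huB, hvB, if_true, if_false]
      · exact hf₂.proper u v (hin u hu huB) (hin v hv hvB) huv
      · exact hcross u v hu hv huB hvB huv
      · exact (hcross v u hv hu hvB huB huv.symm).symm
      · exact hf₁.proper u v (hout u hu huB) (hout v hv hvB) huv
    · intro x hx
      by_cases hxB : x ∈ B
      · simp only [hxB, if_true]
        rw [hf₂.eq x (mem_union_left _ (mem_inter.2 ⟨hx, hxB⟩)), hf₁.eq x hx]
      · simpa [hxB] using hf₁.eq x hx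
    · intro v hv
      by_cases hvB : v ∈ B
      · simpa [hvB] using hf₂.notMem v (mem_inter.2 ⟨hv, hvB⟩)
      · simpa [hvB] using hf₁.notMem v (mem_sdiff.2 ⟨hv, hvB⟩)

/-- A graph that is not `(c + 2ℓ² + 2ℓ)`-colourable has an induced subgraph that is not
`c`-colourable and cannot be separated by fewer than `ℓ` vertices. -/
theorem exists_inseparableOn_not_colorableOn {G : SimpleGraph V} {ℓ c : ℕ} (hℓ : 0 < ℓ)
    {W : Finset V} (hW : ¬ G.ColorableOn W (c + 2 * ℓ ^ 2 + 2 * ℓ)) :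
    ∃ U ⊆ W, G.InseparableOn U ℓ ∧ ¬ G.ColorableOn U c := by
  classical
  by_contra! h
  obtain ⟨f, hf⟩ := exists_isColoringExtension hℓ h _ _ W ∅ (fun _ => 0) (fun _ => ∅)
    (by simp) rfl rfl
    (by simp) (by simp) (by simp) (by simp)
  exact hW ⟨f, fun v hv => hf.lt v (Or.inl hv),
    fun u hu v hv => hf.proper u v (Or.inl hu) (Or.inl hv)⟩

/-! ### Menger's theorem. -/

/-- There is a walk from `u` to `v` avoiding `S`. -/
def JoinedOff (G : SimpleGraph V) (S : Finset V) (u v : V) : Prop :=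
  ∃ p : G.Walk u v, ∀ z ∈ p.support, z ∉ S

theorem JoinedOff.refl {G : SimpleGraph V} {S : Finset V} {u : V} (h : u ∉ S) :
    G.JoinedOff S u u :=
  ⟨Walk.nil, by simpa using h⟩

theorem JoinedOff.symm {G : SimpleGraph V} {S : Finset V} {u v : V} (h : G.JoinedOff S u v) :
    G.JoinedOff S v u := by
  obtain ⟨p, hp⟩ := h
  exact ⟨p.reverse, by simpa using hp⟩

theorem JoinedOff.trans {G : SimpleGraph V} {S : Finset V} {u v w : V} (h : G.JoinedOff S u v)
    (h' : G.JoinedOff S v w) : G.JoinedOff S u w := by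
  obtain ⟨p, hp⟩ := h
  obtain ⟨q, hq⟩ := h'
  refine ⟨p.append q, fun z hz => ?_⟩
  rcases Walk.mem_support_append_iff _ _ |>.1 hz with h | h
  · exact hp z h
  · exact hq z h

theorem JoinedOff.concat {G : SimpleGraph V} {S : Finset V} {u v w : V} (h : G.JoinedOff S u v)
    (h' : G.Adj v w) (hw : w ∉ S) : G.JoinedOff S u w := by
  obtain ⟨p, hp⟩ := h
  refine ⟨p.concat h', fun z hz => ?_⟩
  rw [Walk.support_concat, List.mem_append, List.mem_singleton] at hz
  rcases hz with h | rfl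
  · exact hp z h
  · exact hw

theorem JoinedOff.mono {G : SimpleGraph V} {S T : Finset V} {u v : V} (hST : S ⊆ T)
    (h : G.JoinedOff T u v) : G.JoinedOff S u v := by
  obtain ⟨p, hp⟩ := h
  exact ⟨p, fun z hz hS => hp z hz (hST hS)⟩

theorem JoinedOff.notMem_left {G : SimpleGraph V} {S : Finset V} {u v : V}
    (h : G.JoinedOff S u v) : u ∉ S := by
  obtain ⟨p, hp⟩ := h
  exact hp u p.start_mem_support

theorem JoinedOff.notMem_right {G : SimpleGraph V} {S : Finset V} {u v : V}
    (h : G.JoinedOff S u v) : v ∉ S := h.symm.notMem_left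

/-- `S` meets every walk from `A` to `B`. -/
def Separates (G : SimpleGraph V) (A B S : Finset V) : Prop :=
  ∀ a ∈ A, ∀ b ∈ B, ¬ G.JoinedOff S a b

theorem Separates.symm {G : SimpleGraph V} {A B S : Finset V} (h : G.Separates A B S) :
    G.Separates B A S :=
  fun b hb a ha hab => h a ha b hb hab.symm

/-- There are pairwise disjoint paths from `A` to `B`, indexed by `ι`. -/
def Linkage (G : SimpleGraph V) (A B : Finset V) (ι : Type*) : Prop :=
  ∃ (a b : ι → V) (p : ∀ i, G.Walk (a i) (b i)), (∀ i, a i ∈ A) ∧ (∀ i, b i ∈ B) ∧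
    (∀ i, (p i).IsPath) ∧ ∀ i j v, v ∈ (p i).support → v ∈ (p j).support → i = j

theorem Linkage.symm {G : SimpleGraph V} {A B : Finset V} {ι : Type*} (h : G.Linkage A B ι) :
    G.Linkage B A ι := by
  obtain ⟨a, b, p, ha, hb, hp, hd⟩ := h
  exact ⟨b, a, fun i => (p i).reverse, hb, ha, fun i => (hp i).reverse, fun i j v hi hj =>
    hd i j v (by simpa using hi) (by simpa using hj)⟩

theorem Linkage.comp {G : SimpleGraph V} {A B : Finset V} {ι κ : Type*} (h : G.Linkage A B ι)
    (e : κ ↪ ι) : G.Linkage A B κ := by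
  obtain ⟨a, b, p, ha, hb, hp, hd⟩ := h
  exact ⟨fun i => a (e i), fun i => b (e i), fun i => p (e i), fun i => ha _, fun i => hb _,
    fun i => hp _, fun i j v hi hj => e.injective (hd _ _ v hi hj)⟩

theorem Linkage.mono_graph {G H : SimpleGraph V} {A B : Finset V} {ι : Type*}
    (h : G.Linkage A B ι) (hGH : G ≤ H) : H.Linkage A B ι := by
  obtain ⟨a, b, p, ha, hb, hp, hd⟩ := h
  refine ⟨a, b, fun i => (p i).mapLe hGH, ha, hb, fun i => (hp i).mapLe hGH, fun i j v hi hj =>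
    hd i j v (by simpa using hi) (by simpa using hj)⟩

/-- Disjoint paths have distinct ends, so `k` of them reach each element of a `k`-set once and can
be indexed by it. -/
theorem Linkage.exists_walks_to {G : SimpleGraph V} {A T : Finset V} {k : ℕ}
    (h : G.Linkage A T (Fin k)) (hT : #T = k) :
    ∃ (a : T → V) (p : ∀ t : T, G.Walk (a t) t), (∀ t, a t ∈ A) ∧ (∀ t, (p t).IsPath) ∧
      ∀ s t v, v ∈ (p s).support → v ∈ (p t).support → s = t := by
  obtain ⟨a, b, p, ha, hb, hp, hd⟩ := h
  have hinj : Function.Injective fun i => (⟨b i, hb i⟩ : T) := by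
    intro i j hij
    have : b i = b j := congrArg Subtype.val hij
    exact hd i j (b i) (Walk.end_mem_support _) (by rw [this]; exact Walk.end_mem_support _)
  have hbij := (Fintype.bijective_iff_injective_and_card _).2 ⟨hinj, by simp [hT]⟩
  let e := Equiv.ofBijective _ hbij
  have he : ∀ t : T, b (e.symm t) = t := fun t =>
    congrArg Subtype.val (Equiv.ofBijective_apply_symm_apply _ hbij t)
  refine ⟨fun t => a (e.symm t), fun t => (p (e.symm t)).copy rfl (he t), fun t => ha _,
    fun t => by simpa using hp _, fun s t v hs ht => e.symm.injective (hd _ _ v ?_ ?_)⟩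
  · simpa using hs
  · simpa using ht

/-- A walk from `A` avoiding `R` can reach neither `x` nor `S`: without the edge `xy` this is
excluded by `R`, and entering `x` from `y` would join `A` to `B` off `S` through `y`. So it stays in
the smaller graph off `S` and misses `B`. -/
theorem Separates.of_deleteEdge [DecidableEq V] {G : SimpleGraph V} {x y : V}
    {A B S R : Finset V}
    (hS : (G.deleteEdges {s(x, y)}).Separates A B S)
    (hy : ∃ b ∈ B, (G.deleteEdges {s(x, y)}).JoinedOff S y b)
    (hR : (G.deleteEdges {s(x, y)}).Separates A (insert x S) R) : G.Separates A B R := by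
  set G' := G.deleteEdges {s(x, y)} with hG'
  rintro a ha b hb ⟨w, hw⟩
  have key : ∀ {u v : V} (w : G.Walk u v), (∀ z ∈ w.support, z ∉ R) →
      G'.JoinedOff (R ∪ insert x S) a u → G'.JoinedOff (R ∪ insert x S) a v := by
    intro u v w
    induction w with
    | nil => exact fun _ h => h
    | @cons u v _ huv p ih =>
      intro hw hu
      refine ih (fun z hz => hw z (by simp [hz])) ?_
      have hvR : v ∉ R := hw v (by simp)
      have hux : u ≠ x := fun h => hu.notMem_right (by simp [h])
      by_cases hvT : v ∈ insert x S
      · exfalso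
        by_cases he : s(u, v) = s(x, y)
        · rw [Sym2.eq_iff] at he
          rcases he with ⟨h, _⟩ | ⟨rfl, rfl⟩
          · exact hux h
          · obtain ⟨b', hb', hyb⟩ := hy
            exact hS a ha b' hb' ((hu.mono (fun z hz => by simp [hz])).trans hyb)
        · refine hR a ha v hvT ((hu.mono subset_union_left).concat ?_ hvR)
          rw [hG', deleteEdges_adj]
          exact ⟨huv, he⟩
      · refine hu.concat ?_ (by rw [mem_union]; tauto)
        rw [hG', deleteEdges_adj]
        refine ⟨huv, fun he => ?_⟩
        rw [Set.mem_singleton_iff, Sym2.eq_iff] at he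
        rcases he with ⟨h, _⟩ | ⟨_, h⟩
        · exact hux h
        · exact hvT (by simp [h])
  have haR : a ∉ R := hw a w.start_mem_support
  have haT : a ∉ insert x S := fun h => hR a ha a h (JoinedOff.refl haR)
  have := key w hw (JoinedOff.refl (by rw [mem_union]; tauto))
  exact hS a ha b hb (this.mono (fun z hz => by simp [hz]))

theorem JoinedOff.deleteEdge {G : SimpleGraph V} {S : Finset V} (x y : V) {u v : V}
    (h : G.JoinedOff S u v) :
    (G.deleteEdges {s(x, y)}).JoinedOff S u v ∨ (G.deleteEdges {s(x, y)}).JoinedOff S u x ∨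
      (G.deleteEdges {s(x, y)}).JoinedOff S u y := by
  obtain ⟨w, hw⟩ := h
  induction w with
  | nil => exact Or.inl (JoinedOff.refl (by simpa using hw))
  | @cons u v _ huv p ih =>
    have hu : u ∉ S := hw u (by simp)
    by_cases he : s(u, v) = s(x, y)
    · rw [Sym2.eq_iff] at he
      rcases he with ⟨rfl, _⟩ | ⟨rfl, _⟩
      · exact Or.inr (Or.inl (JoinedOff.refl hu))
      · exact Or.inr (Or.inr (JoinedOff.refl hu))
    · have hv : v ∉ S := hw v (by simp)
      have h1 : (G.deleteEdges {s(x, y)}).JoinedOff S u v :=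
        (JoinedOff.refl hu).concat (by rw [deleteEdges_adj]; exact ⟨huv, he⟩) hv
      exact (ih fun z hz => hw z (by simp [hz])).imp h1.trans (Or.imp h1.trans h1.trans)

/-- The set `S`, too small for `G`, separates once `xy` is deleted, with `x` on the side of `A` and
`y` on that of `B`. So `S ∪ {x}` and `S ∪ {y}` have exactly `k` elements; the induction hypothesis
links them to `A` and `B`, and the two systems are glued along `S` and `xy`. They cannot cross
elsewhere, as `S` separates. -/
theorem linkage_of_separates_deleteEdge [DecidableEq V] {G : SimpleGraph V} {A B S : Finset V}
    {k : ℕ} {x y : V} (hxy : G.Adj x y)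
    (hk : ∀ R, G.Separates A B R → k ≤ #R)
    (ih : ∀ A B : Finset V, (∀ R, (G.deleteEdges {s(x, y)}).Separates A B R → k ≤ #R) →
      (G.deleteEdges {s(x, y)}).Linkage A B (Fin k))
    (hS : (G.deleteEdges {s(x, y)}).Separates A B S) (hSk : #S < k)
    (hx : ∃ a ∈ A, (G.deleteEdges {s(x, y)}).JoinedOff S a x)
    (hy : ∃ b ∈ B, (G.deleteEdges {s(x, y)}).JoinedOff S b y) : G.Linkage A B (Fin k) := by
  set G' := G.deleteEdges {s(x, y)} with hG'
  have hle : G' ≤ G := deleteEdges_le _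
  have hxS : x ∉ S := by obtain ⟨a, _, h⟩ := hx; exact h.notMem_right
  have hyS : y ∉ S := by obtain ⟨b, _, h⟩ := hy; exact h.notMem_right
  have hR1 : ∀ R, G'.Separates A (insert x S) R → k ≤ #R := fun R hR =>
    hk R (hS.of_deleteEdge (hy.imp fun _ h => ⟨h.1, h.2.symm⟩) hR)
  have hswap : G' = G.deleteEdges {s(y, x)} := by rw [hG', Sym2.eq_swap]
  have hR2 : ∀ R, G'.Separates B (insert y S) R → k ≤ #R := by
    intro R hR
    rw [hswap] at hR hS hx
    exact hk R (hS.symm.of_deleteEdge (hx.imp fun _ h => ⟨h.1, h.2.symm⟩) hR).symm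
  have hc1 : #(insert x S) = k := by
    refine le_antisymm ((card_insert_le _ _).trans hSk) (hR1 _ ?_)
    exact fun a _ t ht h => h.notMem_right ht
  have hc2 : #(insert y S) = k := by
    refine le_antisymm ((card_insert_le _ _).trans hSk) (hR2 _ ?_)
    exact fun a _ t ht h => h.notMem_right ht
  obtain ⟨a, p, ha, hp, hpd⟩ := (ih _ _ hR1).exists_walks_to hc1
  obtain ⟨b, q, hb, hq, hqd⟩ := (ih _ _ hR2).exists_walks_to hc2
  have hp_mem : ∀ (t : ↥(insert x S)) z, z ∈ (p t).support → z ∈ S → z = t := by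
    intro t z hz hzS
    have := hpd t ⟨z, mem_insert_of_mem hzS⟩ z hz (Walk.end_mem_support _)
    rw [this]
  have hq_mem : ∀ (t : ↥(insert y S)) z, z ∈ (q t).support → z ∈ S → z = t := by
    intro t z hz hzS
    have := hqd t ⟨z, mem_insert_of_mem hzS⟩ z hz (Walk.end_mem_support _)
    rw [this]
  have hcross : ∀ (s : ↥(insert x S)) (t : ↥(insert y S)) v, v ∈ (p s).support →
      v ∈ (q t).support → (s : V) = t := by
    intro s t v hs ht
    by_contra hst
    refine hS (a s) (ha s) (b t) (hb t)
      ⟨((p s).takeUntil v hs).append ((q t).takeUntil v ht).reverse, fun z hz hzS => ?_⟩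
    rw [Walk.mem_support_append_iff, Walk.support_reverse, List.mem_reverse] at hz
    rcases hz with hz | hz
    · have hzs := hp_mem s z ((p s).support_takeUntil_subset_support hs hz) hzS
      have hv : (s : V) = v := by
        by_contra hne
        exact Walk.endpoint_notMem_support_takeUntil (hp s) hs hne (hzs ▸ hz)
      exact hst (hq_mem t s (hv ▸ ht) (hzs ▸ hzS))
    · have hzt := hq_mem t z ((q t).support_takeUntil_subset_support ht hz) hzS
      have hv : (t : V) = v := by
        by_contra hne
        exact Walk.endpoint_notMem_support_takeUntil (hq t) ht hne (hzt ▸ hz)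
      exact hst (hp_mem s t (hv ▸ hs) (hzt ▸ hzS)).symm
  -- A path ending in `S` continues from the same vertex; the one ending at `x` crosses the edge to
  -- `y`.
  let σ : ↥(insert x S) → ↥(insert y S) := fun t =>
    if h : (t : V) ∈ S then ⟨t, mem_insert_of_mem h⟩ else ⟨y, mem_insert_self _ _⟩
  have hσ : ∀ t : ↥(insert x S), ((t : V) ∈ S ∧ (σ t : V) = t) ∨ ((t : V) = x ∧ (σ t : V) = y) := by
    intro t
    by_cases h : (t : V) ∈ S
    · exact Or.inl ⟨h, by simp [σ, h]⟩
    · exact Or.inr ⟨(mem_insert.1 t.2).resolve_right h, by simp [σ, h]⟩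
  have hwalk : ∀ t : ↥(insert x S), ∃ w : G.Walk (a t) (b (σ t)), w.IsPath ∧
      ∀ v ∈ w.support, v ∈ (p t).support ∨ v ∈ (q (σ t)).support := by
    intro t
    obtain ⟨w, hw⟩ : ∃ w : G.Walk (a t) (b (σ t)),
        ∀ v ∈ w.support, v ∈ (p t).support ∨ v ∈ (q (σ t)).support := by
      have h1 : ∃ w : G.Walk (t : V) (σ t : V), ∀ v ∈ w.support, v = t ∨ v = σ t := by
        rcases hσ t with h | h
        · exact ⟨Walk.nil.copy rfl h.2.symm, by simp⟩
        · exact ⟨(Walk.cons hxy Walk.nil).copy h.1.symm h.2.symm, by simp [h.1, h.2]⟩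
      obtain ⟨w, hw⟩ := h1
      refine ⟨((p t).mapLe hle).append (w.append ((q (σ t)).mapLe hle).reverse), fun v hv => ?_⟩
      simp only [Walk.mem_support_append_iff, Walk.support_reverse, List.mem_reverse,
        Walk.support_mapLe_eq_support] at hv
      rcases hv with h | h | h
      · exact Or.inl h
      · rcases hw v h with rfl | rfl
        · exact Or.inl (Walk.end_mem_support _)
        · exact Or.inr (Walk.end_mem_support _)
      · exact Or.inr h
    exact ⟨w.bypass, w.bypass_isPath, fun v hv => hw v (w.support_bypass_subset_support hv)⟩
  choose w hw hwm using hwalk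
  have hlink : G.Linkage A B ↥(insert x S) := by
    refine ⟨a, fun t => b (σ t), w, ha, fun t => hb _, hw, ?_⟩
    have hσinj : ∀ s t, (σ s : V) = σ t → s = t := by
      intro s t h
      rcases hσ s with ⟨h1, h2⟩ | ⟨h1, h2⟩ <;> rcases hσ t with ⟨h3, h4⟩ | ⟨h3, h4⟩
      · exact Subtype.ext (h2.symm.trans (h.trans h4))
      · exact absurd (h2.symm.trans (h.trans h4) ▸ h1) hyS
      · exact absurd (h4.symm.trans (h.symm.trans h2) ▸ h3) hyS
      · exact Subtype.ext (h1.trans h3.symm)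
    have hσc : ∀ s t : ↥(insert x S), (s : V) = σ t → s = t := by
      intro s t h
      rcases hσ t with ⟨h3, h4⟩ | ⟨h3, h4⟩
      · exact Subtype.ext (h.trans h4)
      · rcases mem_insert.1 s.2 with h5 | h5
        · exact Subtype.ext (h5.trans h3.symm)
        · exact absurd (h.trans h4 ▸ h5) hyS
    intro s t v hs ht
    rcases hwm s v hs with h1 | h1 <;> rcases hwm t v ht with h2 | h2
    · exact hpd s t v h1 h2
    · exact hσc s t (hcross s (σ t) v h1 h2)
    · exact (hσc t s (hcross t (σ s) v h2 h1)).symm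
    · exact hσinj s t (congrArg Subtype.val (hqd _ _ v h1 h2))
  exact hlink.comp (Fintype.equivOfCardEq (by simp [hc1])).toEmbedding

/-- Menger's theorem. -/
theorem linkage_of_forall_separates [Finite V] (G : SimpleGraph V) {k : ℕ} :
    ∀ A B : Finset V, (∀ R, G.Separates A B R → k ≤ #R) → G.Linkage A B (Fin k) := by
  classical
  induction G using WellFoundedLT.induction with
  | ind G ih =>
  intro A B hk
  by_cases hbot : ∃ x y, G.Adj x y
  · obtain ⟨x, y, hxy⟩ := hbot
    have hlt : G.deleteEdges {s(x, y)} < G := by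
      refine lt_of_le_of_ne (deleteEdges_le _) fun h => ?_
      have h2 : (G.deleteEdges {s(x, y)}).Adj x y ↔ G.Adj x y := by rw [h]
      have h3 := h2.2 hxy
      rw [deleteEdges_adj] at h3
      exact h3.2 rfl
    have ih' := ih _ hlt
    by_cases hsep : ∀ R, (G.deleteEdges {s(x, y)}).Separates A B R → k ≤ #R
    · exact (ih' A B hsep).mono_graph hlt.le
    push Not at hsep
    obtain ⟨S, hS, hSk⟩ := hsep
    obtain ⟨a, ha, b, hb, hab⟩ : ∃ a ∈ A, ∃ b ∈ B, G.JoinedOff S a b := by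
      by_contra! h
      exact absurd (hk S h) (by omega)
    have h1 := (hab.deleteEdge x y).resolve_left (hS a ha b hb)
    have h2 := (hab.symm.deleteEdge x y).resolve_left fun h => hS a ha b hb h.symm
    rcases h1 with h1 | h1 <;> rcases h2 with h2 | h2
    · exact absurd (h1.trans h2.symm) (hS a ha b hb)
    · exact linkage_of_separates_deleteEdge hxy hk ih' hS hSk ⟨a, ha, h1⟩ ⟨b, hb, h2⟩
    · rw [Sym2.eq_swap] at ih' hS h1 h2
      exact linkage_of_separates_deleteEdge hxy.symm hk ih' hS hSk ⟨a, ha, h1⟩ ⟨b, hb, h2⟩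
    · exact absurd (h1.trans h2.symm) (hS a ha b hb)
  · push Not at hbot
    -- Without edges all walks are trivial, so `A ∩ B` separates and provides the one-vertex paths.
    have hsep : G.Separates A B (A ∩ B) := by
      rintro a ha b hb ⟨p, hp⟩
      cases p with
      | nil => exact hp a (by simp) (mem_inter.2 ⟨ha, hb⟩)
      | cons h _ => exact hbot _ _ h
    have hc := hk _ hsep
    let e := orderEmbOfCardLe (α := Fin (Nat.card V)) ((A ∩ B).map (Finite.equivFin V).toEmbedding)
      (by simpa using hc)
    have he : ∀ i, (Finite.equivFin V).symm (e i) ∈ A ∩ B := by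
      intro i
      have := orderEmbOfCardLe_mem _ (show k ≤ #((A ∩ B).map (Finite.equivFin V).toEmbedding) by
        simpa using hc) i
      rw [mem_map] at this
      obtain ⟨v, hv, hv'⟩ := this
      have : (Finite.equivFin V).symm (e i) = v := by
        rw [Equiv.symm_apply_eq]; exact hv'.symm
      rwa [this]
    refine ⟨fun i => (Finite.equivFin V).symm (e i), fun i => (Finite.equivFin V).symm (e i),
      fun i => Walk.nil, fun i => (mem_inter.1 (he i)).1, fun i => (mem_inter.1 (he i)).2,
      fun i => Walk.IsPath.nil, fun i j v hi hj => ?_⟩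
    simp only [Walk.support_nil, List.mem_singleton] at hi hj
    exact e.injective ((Finite.equivFin V).symm.injective (hi.symm.trans hj))

/-! ### Cycles, arcs, and combining two cycles. -/

/-- The graph on `V` whose edges are the edges of `G` inside `U`. -/
def restrictTo (G : SimpleGraph V) (U : Finset V) : SimpleGraph V where
  Adj u v := G.Adj u v ∧ u ∈ U ∧ v ∈ U
  symm := ⟨fun _ _ h => ⟨h.1.symm, h.2.2, h.2.1⟩⟩
  loopless := ⟨fun _ h => G.loopless.irrefl _ h.1⟩

theorem restrictTo_le (G : SimpleGraph V) (U : Finset V) : G.restrictTo U ≤ G :=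
  fun _ _ h => h.1

theorem Walk.mem_of_restrictTo {G : SimpleGraph V} {U : Finset V} {u v : V}
    (p : (G.restrictTo U).Walk u v) (hu : u ∈ U) : ∀ x ∈ p.support, x ∈ U := by
  induction p with
  | nil => simpa using hu
  | cons h p ih =>
    intro x hx
    rcases List.mem_cons.1 hx with rfl | hx
    · exact hu
    · exact ih h.2.2 x hx

/-- `G` has a cycle of length `n` inside `U`. -/
def HasCycleIn (G : SimpleGraph V) (U : Finset V) (n : ℕ) : Prop :=
  ∃ (v : V) (w : G.Walk v v), w.IsCycle ∧ w.length = n ∧ ∀ x ∈ w.support, x ∈ U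

theorem HasCycleIn.mono {G : SimpleGraph V} {U W : Finset V} {n : ℕ} (hUW : U ⊆ W)
    (h : G.HasCycleIn U n) : G.HasCycleIn W n := by
  obtain ⟨v, w, hw, hn, hU⟩ := h
  exact ⟨v, w, hw, hn, fun x hx => hUW (hU x hx)⟩

/-- The map `c` runs periodically around a cycle of length `n`. -/
structure IsCyclicMap (G : SimpleGraph V) (n : ℕ) (c : ℕ → V) : Prop where
  three_le : 3 ≤ n
  adj : ∀ i, G.Adj (c i) (c (i + 1))
  eq_iff : ∀ i j, c i = c j ↔ i % n = j % n

theorem Walk.IsCycle.isCyclicMap {G : SimpleGraph V} {v : V} {w : G.Walk v v} (hw : w.IsCycle) :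
    G.IsCyclicMap w.length fun i => w.getVert (i % w.length) := by
  have h3 := hw.three_le_length
  refine ⟨h3, fun i => ?_, fun i j => ⟨fun h => ?_, fun h => by simp only [h]⟩⟩
  · have hi := Nat.mod_lt i (show w.length > 0 by omega)
    have h := w.adj_getVert_succ hi
    rw [Nat.add_mod, Nat.mod_eq_of_lt (show 1 < w.length by omega)]
    rcases Nat.lt_or_ge (i % w.length + 1) w.length with h' | h'
    · rwa [Nat.mod_eq_of_lt h']
    · have : i % w.length + 1 = w.length := by omega
      rw [this] at h ⊢
      simpa using h
  · have hi := Nat.mod_lt i (show w.length > 0 by omega)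
    have hj := Nat.mod_lt j (show w.length > 0 by omega)
    exact hw.getVert_injOn' (by simp only [Set.mem_ofPred_eq]; omega)
      (by simp only [Set.mem_ofPred_eq]; omega) h

namespace IsCyclicMap

variable {G : SimpleGraph V} {n : ℕ} {c : ℕ → V}

theorem eq_iff_of_lt (h : G.IsCyclicMap n c) {i j d : ℕ} (hi : i < d + n) (hj : j < d + n)
    (hdi : d ≤ i) (hdj : d ≤ j) : c i = c j ↔ i = j := by
  rw [h.eq_iff]
  refine ⟨fun hij => ?_, fun hij => by rw [hij]⟩
  have h1 : (i - d) % n = (j - d) % n := by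
    have : i - d + d ≡ j - d + d [MOD n] := by
      rw [Nat.sub_add_cancel hdi, Nat.sub_add_cancel hdj]; exact hij
    exact Nat.ModEq.add_right_cancel' d this
  rw [Nat.mod_eq_of_lt (by omega), Nat.mod_eq_of_lt (by omega)] at h1
  omega

theorem apply_add (h : G.IsCyclicMap n c) (i : ℕ) : c (i + n) = c i := by
  rw [h.eq_iff]; simp

theorem exists_lt (h : G.IsCyclicMap n c) (i : ℕ) : ∃ j < n, c i = c j :=
  ⟨i % n, Nat.mod_lt _ (by have := h.three_le; omega), by rw [h.eq_iff]; simp⟩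

theorem card_image [DecidableEq V] (h : G.IsCyclicMap n c) : #((range n).image c) = n := by
  rw [card_image_of_injOn, card_range]
  intro i hi j hj hij
  rw [coe_range, Set.mem_Iio] at hi hj
  exact (h.eq_iff_of_lt (d := 0) (by omega) (by omega) (by omega) (by omega)).1 hij

theorem mem_image [DecidableEq V] (h : G.IsCyclicMap n c) (i : ℕ) : c i ∈ (range n).image c := by
  obtain ⟨j, hj, h⟩ := h.exists_lt i
  rw [h]
  exact mem_image_of_mem _ (mem_range.2 hj)

theorem exists_arc (h : G.IsCyclicMap n c) (i d : ℕ) : ∃ w : G.Walk (c i) (c (i + d)),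
    w.length = d ∧ (∀ v ∈ w.support, ∃ j ≤ d, v = c (i + j)) ∧ (d < n → w.IsPath) := by
  induction d with
  | zero => exact ⟨Walk.nil, rfl, by simp, fun _ => Walk.IsPath.nil⟩
  | succ d ih =>
    obtain ⟨w, hl, hs, hp⟩ := ih
    refine ⟨w.concat (h.adj (i + d)), by simp [hl], ?_, fun hd => ?_⟩
    · intro v hv
      rw [Walk.support_concat, List.mem_append, List.mem_singleton] at hv
      rcases hv with hv | rfl
      · obtain ⟨j, hj, rfl⟩ := hs v hv
        exact ⟨j, by omega, rfl⟩
      · exact ⟨d + 1, le_rfl, rfl⟩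
    · refine (hp (by omega)).concat (fun hm => ?_) _
      obtain ⟨j, hj, he⟩ := hs _ hm
      rw [h.eq_iff_of_lt (d := i) (by omega) (by omega) (by omega) (by omega)] at he
      omega

/-- Between two vertices of a cycle there is an arc at least half as long as the cycle. -/
theorem exists_long_arc (h : G.IsCyclicMap n c) {i j : ℕ} (hij : c i ≠ c j) :
    ∃ w : G.Walk (c i) (c j), w.IsPath ∧ n ≤ 2 * w.length ∧ ∀ v ∈ w.support, ∃ k, v = c k := by
  have key : ∀ i j, i < j → j < n → (∃ w : G.Walk (c i) (c j), w.IsPath ∧ n ≤ 2 * w.length ∧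
      ∀ v ∈ w.support, ∃ k, v = c k) ∧ (∃ w : G.Walk (c j) (c i), w.IsPath ∧ n ≤ 2 * w.length ∧
      ∀ v ∈ w.support, ∃ k, v = c k) := by
    intro i j hij hj
    suffices hs : ∃ w : G.Walk (c i) (c j), w.IsPath ∧ n ≤ 2 * w.length ∧
        ∀ v ∈ w.support, ∃ k, v = c k by
      refine ⟨hs, ?_⟩
      obtain ⟨w, hw, hl, hs⟩ := hs
      exact ⟨w.reverse, hw.reverse, by simpa using hl, by simpa using hs⟩
    rcases Nat.lt_or_ge (2 * (j - i)) n with hlt | hge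
    · obtain ⟨w, hl, hs, hp⟩ := h.exists_arc j (n - (j - i))
      have he : c (j + (n - (j - i))) = c i := by
        rw [show j + (n - (j - i)) = i + n by omega, h.apply_add]
      refine ⟨(w.copy rfl he).reverse, ?_, ?_, ?_⟩
      · simpa using hp (by omega)
      · simp only [Walk.length_reverse, Walk.length_copy, hl]; omega
      · intro v hv
        rw [Walk.support_reverse, List.mem_reverse, Walk.support_copy] at hv
        obtain ⟨k, _, hk⟩ := hs v hv
        exact ⟨_, hk⟩
    · obtain ⟨w, hl, hs, hp⟩ := h.exists_arc i (j - i)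
      have he : c (i + (j - i)) = c j := by rw [Nat.add_sub_cancel' hij.le]
      refine ⟨w.copy rfl he, by simpa using hp (by omega), by simpa [hl] using hge, ?_⟩
      intro v hv
      rw [Walk.support_copy] at hv
      obtain ⟨k, _, hk⟩ := hs v hv
      exact ⟨_, hk⟩
  obtain ⟨i', hi', hi⟩ := h.exists_lt i
  obtain ⟨j', hj', hj⟩ := h.exists_lt j
  rw [hi, hj] at hij ⊢
  rcases lt_trichotomy i' j' with hlt | rfl | hgt
  · exact (key i' j' hlt hj').1
  · exact absurd rfl hij
  · exact (key j' i' hgt hi').2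

end IsCyclicMap

theorem Walk.IsPath.append_of_inter {G : SimpleGraph V} {u v w : V} {p : G.Walk u v}
    {q : G.Walk v w} (hp : p.IsPath) (hq : q.IsPath)
    (h : ∀ x ∈ p.support, x ∈ q.support → x = v) : (p.append q).IsPath := by
  rw [Walk.isPath_def, Walk.support_append, List.nodup_append']
  refine ⟨hp.support_nodup, hq.support_nodup.tail, fun x hx hx' => ?_⟩
  have hxv := h x hx (List.mem_of_mem_tail hx')
  have := hq.support_nodup
  rw [← Walk.cons_tail_support, List.nodup_cons] at this
  exact this.1 (hxv ▸ hx')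

theorem Walk.IsPath.isCycle_append_of_inter {G : SimpleGraph V} {u v : V} {p : G.Walk u v}
    {q : G.Walk v u} (hp : p.IsPath) (hq : q.IsPath)
    (h : ∀ x ∈ p.support, x ∈ q.support → x = u ∨ x = v) (hl : 1 < p.length ∨ 1 < q.length) :
    (p.append q).IsCycle := by
  refine hp.isCycle_append hq (fun x hx hx' => ?_) hl
  have h1 := hp.support_nodup
  have h2 := hq.support_nodup
  rw [← Walk.cons_tail_support, List.nodup_cons] at h1 h2
  rcases h x (List.mem_of_mem_tail hx) (List.mem_of_mem_tail hx') with rfl | rfl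
  · exact h1.1 hx
  · exact h2.1 hx'

theorem HasCycleIn.exists_isCyclicMap {G : SimpleGraph V} {U : Finset V} {n : ℕ}
    (h : G.HasCycleIn U n) : ∃ c, G.IsCyclicMap n c ∧ ∀ i, c i ∈ U := by
  obtain ⟨v, w, hw, rfl, hU⟩ := h
  exact ⟨_, hw.isCyclicMap, fun i => hU _ (Walk.getVert_mem_support _ _)⟩

theorem HasCycleIn.le_card {G : SimpleGraph V} {U : Finset V} {n : ℕ}
    (h : G.HasCycleIn U n) : n ≤ #U := by
  classical
  obtain ⟨c, hc, hU⟩ := h.exists_isCyclicMap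
  rw [← hc.card_image]
  exact card_le_card fun x hx => by
    obtain ⟨i, _, rfl⟩ := Finset.mem_image.1 hx
    exact hU i

theorem HasCycleIn.exists_longest {G : SimpleGraph V} {U : Finset V} {n : ℕ}
    (h : G.HasCycleIn U n) : ∃ m, n ≤ m ∧ G.HasCycleIn U m ∧ ∀ k, G.HasCycleIn U k → k ≤ m := by
  classical
  exact ⟨Nat.findGreatest (G.HasCycleIn U) #U, Nat.le_findGreatest h.le_card h,
    Nat.findGreatest_spec h.le_card h, fun k hk => Nat.le_findGreatest hk.le_card hk⟩

/-- A walk from `A` to `B` contains a path from `A` to `B` meeting `A` and `B` only at its ends. -/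
theorem Walk.exists_isPath_trim [DecidableEq V] {G : SimpleGraph V} {A B : Set V} {u v : V}
    (w : G.Walk u v) (hu : u ∈ A) (hv : v ∈ B) :
    ∃ (a b : V) (p : G.Walk a b), a ∈ A ∧ b ∈ B ∧ p.IsPath ∧ (∀ x ∈ p.support, x ∈ w.support) ∧
      (∀ x ∈ p.support, x ∈ A → x = a) ∧ ∀ x ∈ p.support, x ∈ B → x = b := by
  classical
  have hex : ∃ n, ∃ (a b : V) (p : G.Walk a b), a ∈ A ∧ b ∈ B ∧
      (∀ x ∈ p.support, x ∈ w.support) ∧ p.length = n :=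
    ⟨_, u, v, w, hu, hv, fun _ h => h, rfl⟩
  -- A shortest such walk works: a further vertex of `A` or `B` on it would allow a shorter one.
  obtain ⟨a, b, p, ha, hb, hs, hl⟩ := Nat.find_spec hex
  have hmin : ∀ (a' b' : V) (q : G.Walk a' b'), a' ∈ A → b' ∈ B →
      (∀ x ∈ q.support, x ∈ w.support) → p.bypass.length ≤ q.length := by
    intro a' b' q ha' hb' hq
    refine p.length_bypass_le_length.trans ?_
    rw [hl]
    exact Nat.find_min' hex ⟨a', b', q, ha', hb', hq, rfl⟩
  have hs' : ∀ x ∈ p.bypass.support, x ∈ w.support :=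
    fun x hx => hs x (p.support_bypass_subset_support hx)
  refine ⟨a, b, p.bypass, ha, hb, p.bypass_isPath, hs', fun x hx hxA => ?_, fun x hx hxB => ?_⟩
  · by_contra hne
    have := hmin x b (p.bypass.dropUntil x hx) hxA hb
      (fun y hy => hs' y (p.bypass.support_dropUntil_subset_support hx hy))
    exact absurd (Walk.length_dropUntil_lt_length hx hne) (by omega)
  · by_contra hne
    have := hmin a x (p.bypass.takeUntil x hx) ha hxB
      (fun y hy => hs' y (p.bypass.support_takeUntil_subset_support hx hy))
    exact absurd (Walk.length_takeUntil_lt_length hx hne) (by omega)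

/-- Two disjoint cycles joined by two disjoint paths contain a cycle consisting of the paths, a
long arc of the second cycle and any one of the two arcs of the first. -/
theorem exists_isCycle_of_two_paths {G : SimpleGraph V} {n n' : ℕ} {c c' : ℕ → V}
    (hc : G.IsCyclicMap n c) (hc' : G.IsCyclicMap n' c') (hcc' : ∀ i j, c i ≠ c' j)
    {i₁ i₂ j₁ j₂ : ℕ} (h12 : i₁ < i₂) (h21 : i₂ < i₁ + n)
    (p : G.Walk (c i₁) (c' j₁)) (q : G.Walk (c i₂) (c' j₂)) (hp : p.IsPath) (hq : q.IsPath)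
    (hpq : ∀ x ∈ p.support, x ∉ q.support)
    (hpc : ∀ k, c k ∈ p.support → c k = c i₁) (hqc : ∀ k, c k ∈ q.support → c k = c i₂)
    (hpc' : ∀ k, c' k ∈ p.support → c' k = c' j₁) (hqc' : ∀ k, c' k ∈ q.support → c' k = c' j₂) :
    ∃ w : G.Walk (c i₂) (c i₂), w.IsCycle ∧ 2 * (n - (i₂ - i₁)) + n' ≤ 2 * w.length ∧
      ∀ x ∈ w.support, (∃ k, x = c k) ∨ (∃ k, x = c' k) ∨ x ∈ p.support ∨ x ∈ q.support := by
  obtain ⟨a, hal, has, hap⟩ := hc.exists_arc i₂ (n - (i₂ - i₁))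
  have he : c (i₂ + (n - (i₂ - i₁))) = c i₁ := by
    rw [show i₂ + (n - (i₂ - i₁)) = i₁ + n by omega, hc.apply_add]
  have hjj : c' j₁ ≠ c' j₂ := fun h =>
    hpq (c' j₁) (Walk.end_mem_support _) (by rw [h]; exact Walk.end_mem_support _)
  obtain ⟨d, hdp, hdl, hds⟩ := hc'.exists_long_arc hjj
  have h1 : (d.append q.reverse).IsPath := by
    refine hdp.append_of_inter hq.reverse fun x hx hx' => ?_
    obtain ⟨k, rfl⟩ := hds x hx
    exact hqc' k (by simpa using hx')
  have h2 : (p.append (d.append q.reverse)).IsPath := by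
    refine hp.append_of_inter h1 fun x hx hx' => ?_
    rw [Walk.mem_support_append_iff, Walk.support_reverse, List.mem_reverse] at hx'
    rcases hx' with hx' | hx'
    · obtain ⟨k, rfl⟩ := hds x hx'
      exact hpc' k hx
    · exact absurd hx' (hpq x hx)
  have hpl : 0 < p.length := by
    rw [Nat.pos_iff_ne_zero]
    intro h
    exact hcc' _ _ (Walk.eq_of_length_eq_zero h)
  have hql : 0 < q.length := by
    rw [Nat.pos_iff_ne_zero]
    intro h
    exact hcc' _ _ (Walk.eq_of_length_eq_zero h)
  refine ⟨(a.copy rfl he).append (p.append (d.append q.reverse)), ?_, ?_, ?_⟩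
  · refine Walk.IsPath.isCycle_append_of_inter (by simpa using hap (by omega)) h2 ?_ ?_
    · intro x hx hx'
      rw [Walk.support_copy] at hx
      obtain ⟨k, _, rfl⟩ := has x hx
      rw [Walk.mem_support_append_iff, Walk.mem_support_append_iff, Walk.support_reverse,
        List.mem_reverse] at hx'
      rcases hx' with hx' | hx' | hx'
      · exact Or.inr (hpc _ hx')
      · obtain ⟨m, hm⟩ := hds _ hx'
        exact absurd hm (hcc' _ _)
      · exact Or.inl (hqc _ hx')
    · right
      simp only [Walk.length_append, Walk.length_reverse]
      omega
  · simp only [Walk.length_append, Walk.length_reverse, Walk.length_copy, hal]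
    omega
  · intro x hx
    rw [Walk.mem_support_append_iff, Walk.mem_support_append_iff, Walk.mem_support_append_iff,
      Walk.support_copy, Walk.support_reverse, List.mem_reverse] at hx
    rcases hx with hx | hx | hx | hx
    · obtain ⟨k, _, rfl⟩ := has x hx
      exact Or.inl ⟨_, rfl⟩
    · exact Or.inr (Or.inr (Or.inl hx))
    · exact Or.inr (Or.inl (hds x hx))
    · exact Or.inr (Or.inr (Or.inr hx))

/-- By Menger it suffices to exclude a separator `R` with fewer than `ℓ` vertices; the vertices
reachable from `A` off `R` would form one side of a forbidden separation. -/
theorem InseparableOn.linkage [Finite V] {G : SimpleGraph V} {U A B : Finset V} {ℓ : ℕ}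
    (hU : G.InseparableOn U ℓ) (hA : A ⊆ U) (hB : B ⊆ U) (hAc : ℓ ≤ #A) (hBc : ℓ ≤ #B) :
    (G.restrictTo U).Linkage A B (Fin ℓ) := by
  classical
  apply linkage_of_forall_separates
  intro R hR
  by_contra! hlt
  set H := G.restrictTo U with hH
  set A₀ : Finset V := {v ∈ U | ∃ a ∈ A, H.JoinedOff R a v} with hA₀
  have hA₀R : ∀ v ∈ A₀, v ∉ R := by
    intro v hv
    obtain ⟨_, a, _, h⟩ := mem_filter.1 hv
    exact h.notMem_right
  have hex : ∀ A : Finset V, ℓ ≤ #A → ∃ a ∈ A, a ∉ R := by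
    intro A hA
    by_contra! h
    exact absurd (card_le_card h) (by omega)
  obtain ⟨a, ha, haR⟩ := hex A hAc
  obtain ⟨b, hb, hbR⟩ := hex B hBc
  have hdis : Disjoint A₀ (U \ (A₀ ∪ R)) := by
    rw [Finset.disjoint_left]
    intro x hx hx'
    simp only [mem_sdiff, mem_union] at hx'
    tauto
  have := hU A₀ (R ∩ U) (U \ (A₀ ∪ R)) ?_ hdis ?_ ?_ ?_
    ((card_le_card inter_subset_left).trans_lt hlt)
  · rcases this with h | h
    · have : a ∈ A₀ := mem_filter.2 ⟨hA ha, a, ha, JoinedOff.refl haR⟩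
      simp [h] at this
    · have : b ∈ U \ (A₀ ∪ R) := by
        rw [mem_sdiff, mem_union]
        refine ⟨hB hb, ?_⟩
        rintro (hbA | hbR')
        · obtain ⟨_, a', ha', hj⟩ := mem_filter.1 hbA
          exact hR a' ha' b hb hj
        · exact hbR hbR'
      simp [h] at this
  · intro v
    have : v ∈ A₀ → v ∈ U := fun h => (mem_filter.1 h).1
    simp only [mem_inter, mem_sdiff, mem_union]
    tauto
  · rw [Finset.disjoint_left]
    intro x hx hx'
    exact hA₀R x hx (mem_inter.1 hx').1
  · rw [Finset.disjoint_left]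
    intro x hx hx'
    simp only [mem_inter, mem_sdiff, mem_union] at hx hx'
    tauto
  · intro x hx y hy hxy
    obtain ⟨hxU, a', ha', hj⟩ := mem_filter.1 hx
    simp only [mem_sdiff, mem_union, not_or] at hy
    exact hy.2.1 (mem_filter.2 ⟨hy.1, a', ha', hj.concat ⟨hxy, hxU, hy.1⟩ hy.2.2⟩)

/-- In an inseparable graph, two disjoint cycles can be combined to a long one. -/
theorem InseparableOn.exists_long_cycle [Finite V] {G : SimpleGraph V} {U : Finset V} {ℓ : ℕ}
    (hU : G.InseparableOn U ℓ) (hℓ : 2 ≤ ℓ) {n n' : ℕ} {c c' : ℕ → V}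
    (hc : G.IsCyclicMap n c) (hc' : G.IsCyclicMap n' c') (hcc' : ∀ i j, c i ≠ c' j)
    (hcU : ∀ i, c i ∈ U) (hcU' : ∀ i, c' i ∈ U) (hn : ℓ ≤ n) (hn' : ℓ ≤ n') :
    ∃ m, G.HasCycleIn U m ∧ 2 * (n - n / (ℓ - 1)) + n' ≤ 2 * m := by
  classical
  obtain ⟨a, b, p, ha, hb, hp, hd⟩ := hU.linkage (A := (range n).image c) (B := (range n').image c')
    (by intro x hx; obtain ⟨i, _, rfl⟩ := Finset.mem_image.1 hx; exact hcU i)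
    (by intro x hx; obtain ⟨i, _, rfl⟩ := Finset.mem_image.1 hx; exact hcU' i)
    (by rw [hc.card_image]; exact hn) (by rw [hc'.card_image]; exact hn')
  have htrim : ∀ i, ∃ (s t : ℕ) (w : G.Walk (c s) (c' t)), s < n ∧ w.IsPath ∧
      (∀ x ∈ w.support, x ∈ (p i).support ∧ x ∈ U) ∧ (∀ k, c k ∈ w.support → c k = c s) ∧
      ∀ k, c' k ∈ w.support → c' k = c' t := by
    intro i
    obtain ⟨u, v, w, hu, hv, hw, hs, hA, hB⟩ := ((p i).mapLe (G.restrictTo_le U)).exists_isPath_trim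
      (A := ((range n).image c : Finset V)) (B := ((range n').image c' : Finset V)) (ha i) (hb i)
    obtain ⟨s, hs', rfl⟩ := Finset.mem_image.1 (mem_coe.1 hu)
    obtain ⟨t, _, rfl⟩ := Finset.mem_image.1 (mem_coe.1 hv)
    refine ⟨s, t, w, mem_range.1 hs', hw, fun x hx => ?_, fun k hk => hA _ hk (hc.mem_image k),
      fun k hk => hB _ hk (hc'.mem_image k)⟩
    have := hs x hx
    rw [Walk.support_mapLe_eq_support] at this
    refine ⟨this, (p i).mem_of_restrictTo ?_ x this⟩
    obtain ⟨j, _, hj⟩ := Finset.mem_image.1 (ha i)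
    exact hj ▸ hcU j
  choose s t w hsn hw hwp hwc hwc' using htrim
  have hdis : ∀ i j, i ≠ j → ∀ x ∈ (w i).support, x ∉ (w j).support := fun i j hij x hx hx' =>
    hij (hd i j x (hwp i x hx).1 (hwp j x hx').1)
  -- Cut the indices below `n` into `ℓ - 1` blocks of length `r`. Two of the `ℓ` ends lie in one
  -- block, hence at distance at most `n / (ℓ - 1)`.
  set r := n / (ℓ - 1) + 1 with hr
  have hr0 : 0 < r := Nat.succ_pos _
  have hlt : n < (ℓ - 1) * r := Nat.lt_mul_div_succ n (by omega)
  obtain ⟨i, -, j, -, hij, hijr⟩ := exists_ne_map_eq_of_card_lt_of_maps_to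
    (s := (univ : Finset (Fin ℓ))) (t := range (ℓ - 1)) (f := fun i => s i / r)
    (by rw [card_range, card_univ, Fintype.card_fin]; omega) (fun i _ => by
      simp only [coe_range, Set.mem_Iio]
      rw [Nat.div_lt_iff_lt_mul hr0]
      exact (hsn i).trans hlt)
  have hfin : ∀ i j, s i / r = s j / r → s i < s j →
      ∃ m, G.HasCycleIn U m ∧ 2 * (n - n / (ℓ - 1)) + n' ≤ 2 * m := by
    intro i j hijr hlt
    have hij : i ≠ j := fun h => by rw [h] at hlt; exact lt_irrefl _ hlt
    have hdiff : s j - s i ≤ n / (ℓ - 1) := by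
      have h1 := Nat.div_add_mod (s i) r
      have h2 := Nat.div_add_mod (s j) r
      have h3 := Nat.mod_lt (s j) hr0
      rw [hijr] at h1
      refine Nat.lt_succ_iff.1 (show s j - s i < r from ?_)
      omega
    obtain ⟨z, hz, hzl, hzs⟩ := exists_isCycle_of_two_paths hc hc' hcc' hlt
      ((hsn j).trans_le (Nat.le_add_left _ _)) (w i) (w j) (hw i) (hw j) (hdis i j hij) (hwc i)
      (hwc j) (hwc' i) (hwc' j)
    refine ⟨_, ⟨_, z, hz, rfl, fun x hx => ?_⟩, by omega⟩
    rcases hzs x hx with ⟨k, rfl⟩ | ⟨k, rfl⟩ | h | h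
    · exact hcU k
    · exact hcU' k
    · exact (hwp i x h).2
    · exact (hwp j x h).2
  rcases lt_trichotomy (s i) (s j) with h | h | h
  · exact hfin i j hijr h
  · exact absurd (by rw [h]; exact Walk.start_mem_support (w j)) (hdis i j hij _ (Walk.start_mem_support (w i)))
  · exact hfin j i hijr.symm h

/-! ### Existence of a long cycle. -/

/-- A graph that is not `c`-colourable has a cycle longer than `c`. -/
theorem exists_hasCycleIn_gt [Finite V] {G : SimpleGraph V} {U : Finset V} {c : ℕ} (hc : 2 ≤ c)
    (hU : ¬ G.ColorableOn U c) : ∃ n, c < n ∧ G.HasCycleIn U n := by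
  classical
  induction U using Finset.strongInduction with
  | H U ih =>
  by_cases hdeg : ∃ u ∈ U, #{v ∈ U | G.Adj u v} < c
  -- A vertex with fewer than `c` neighbours can be coloured last, so it may be deleted.
  · obtain ⟨u, hu, hd⟩ := hdeg
    have hcol : ¬ G.ColorableOn (U.erase u) c := by
      rintro ⟨f, hf, hfp⟩
      apply hU
      obtain ⟨a, ha, hna⟩ : ∃ a ∈ range c, a ∉ image f {v ∈ U | G.Adj u v} :=
        exists_mem_notMem_of_card_lt_card (card_image_le.trans_lt (by simpa using hd))
      have key : ∀ v ∈ U, G.Adj u v → a ≠ f v := fun v hv huv h =>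
        hna (mem_image.2 ⟨v, mem_filter.2 ⟨hv, huv⟩, h.symm⟩)
      refine ⟨Function.update f u a, fun v hv => ?_, fun x hx y hy hxy => ?_⟩
      · by_cases h : v = u
        · subst h; simpa using ha
        · rw [Function.update_of_ne h]
          exact hf v (by simpa [h] using hv)
      · by_cases h : x = u
        · subst h
          rw [Function.update_self, Function.update_of_ne hxy.ne']
          exact key y hy hxy
        · by_cases h' : y = u
          · subst h'
            rw [Function.update_self, Function.update_of_ne h]
            exact (key x hx hxy.symm).symm
          · rw [Function.update_of_ne h, Function.update_of_ne h']
            exact hfp x (by simpa [h] using hx) y (by simpa [h'] using hy) hxy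
    obtain ⟨n, hn, hcyc⟩ := ih (U.erase u) (erase_ssubset hu) hcol
    exact ⟨n, hn, hcyc.mono (erase_subset _ _)⟩
  push Not at hdeg
  have hUne : U.Nonempty := by
    rw [nonempty_iff_ne_empty]
    rintro rfl
    exact hU ⟨fun _ => 0, by simp, by simp⟩
  obtain ⟨u₀, hu₀⟩ := hUne
  have : Nonempty V := ⟨u₀⟩
  obtain ⟨u, v, p, hp, hmax⟩ :=
    Walk.exists_isPath_forall_isPath_length_le_length (G.restrictTo U)
  have huU : u ∈ U := by
    obtain ⟨v₀, hv₀⟩ := card_pos.1 ((show 0 < c by omega).trans_le (hdeg u₀ hu₀))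
    rw [mem_filter] at hv₀
    have hadj : (G.restrictTo U).Adj u₀ v₀ := ⟨hv₀.2, hu₀, hv₀.1⟩
    have := hmax _ _ hadj.toWalk hadj.isPath_toWalk
    rw [Adj.length_toWalk] at this
    cases p with
    | nil => simp at this
    | cons h _ => exact h.2.1
  have hnbr : ∀ x ∈ U, G.Adj u x → x ∈ p.support := by
    intro x hx hux
    by_contra hxp
    have hadj : (G.restrictTo U).Adj x u := ⟨hux.symm, hx, huU⟩
    have := hmax _ _ (Walk.cons hadj p) (hp.cons hxp)
    rw [Walk.length_cons] at this
    omega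
  -- All neighbours of the start `u` of a longest path lie on it, at distinct positive positions;
  -- there are at least `c` of them, so one is at position at least `c` and closes the cycle.
  obtain ⟨x, hx, hux, hxp, hxl⟩ : ∃ x ∈ U, ∃ (_ : G.Adj u x) (h : x ∈ p.support),
      c ≤ (p.takeUntil x h).length := by
    by_contra! h
    let φ : V → ℕ := fun x => if h : x ∈ p.support then (p.takeUntil x h).length else 0
    have hφ : ∀ x, x ∈ p.support → p.getVert (φ x) = x := by
      intro x hx
      simp only [φ, hx, dif_pos]
      exact Walk.getVert_length_takeUntil hx
    have hle : #{v ∈ U | G.Adj u v} ≤ #(Ico 1 c) := by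
      refine card_le_card_of_injOn φ (fun x hx => ?_) (fun x hx y hy hxy => ?_)
      · rw [mem_coe, mem_filter] at hx
        have hxp := hnbr x hx.1 hx.2
        have h1 := hφ x hxp
        have h2 := h x hx.1 hx.2 hxp
        have h3 : φ x = (p.takeUntil x hxp).length := by simp only [φ, hxp, dif_pos]
        rw [mem_coe, mem_Ico]
        refine ⟨?_, h3 ▸ h2⟩
        rw [Nat.one_le_iff_ne_zero]
        intro h0
        rw [h0, Walk.getVert_zero] at h1
        exact hx.2.ne h1
      · rw [mem_coe, mem_filter] at hx hy
        rw [← hφ x (hnbr x hx.1 hx.2), hxy, hφ y (hnbr y hy.1 hy.2)]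
    have := (hdeg u huU).trans hle
    rw [Nat.card_Ico] at this
    omega
  have hq := hp.takeUntil hxp
  have hadj : (G.restrictTo U).Adj x u := ⟨hux.symm, hx, huU⟩
  have hcyc : (Walk.cons hadj (p.takeUntil x hxp)).IsCycle := by
    rw [Walk.cons_isCycle_iff]
    refine ⟨hq, fun hm => ?_⟩
    rw [Sym2.eq_swap] at hm
    have := hq.length_eq_one_of_mem_edges hm
    omega
  refine ⟨_, ?_, x, (Walk.cons hadj (p.takeUntil x hxp)).mapLe (G.restrictTo_le U), hcyc.mapLe _,
    rfl, ?_⟩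
  · rw [Walk.length_map, Walk.length_cons]
    omega
  · rw [Walk.support_mapLe_eq_support]
    exact Walk.mem_of_restrictTo _ hx

/-- The term `η c³` makes the bound trivial for small `c`, so that the induction needs no lower
bound on the number of colours left. The clause `c < n` ensures that the cycle from the induction
has at least `ℓ` vertices. -/
theorem exists_hasCycleIn_min {β : ℝ} (hβ0 : 0 < β) (hβ : β < 1 / 4) :
    ∃ η : ℝ, 0 < η ∧ ∀ c : ℕ, 2 ≤ c → ∀ {V : Type*} [Finite V] (G : SimpleGraph V),
      G.CliqueFree 3 → ∀ U : Finset V, ¬ G.ColorableOn U c →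
      ∃ n : ℕ, G.HasCycleIn U n ∧ c < n ∧
        min (β * c ^ 2 * Real.log c) (η * c ^ 3) ≤ n := by
  obtain ⟨β', hβ'1, hβ'2⟩ := exists_between hβ
  have hβ'0 : 0 < β' := hβ0.trans hβ'1
  have hq : √(β / β') < 1 := by
    rw [Real.sqrt_lt' one_pos, one_pow, div_lt_one hβ'0]; exact hβ'1
  obtain ⟨t, ht1, ht2⟩ := exists_between hq
  have ht0 : 0 < t := (Real.sqrt_nonneg _).trans_lt ht1
  obtain ⟨δ, hδt, hδ0⟩ : ∃ δ : ℝ, t = 1 - 2 * δ ∧ 0 < δ := ⟨(1 - t) / 2, by ring, by linarith⟩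
  have hδ1 : δ < 1 := by linarith
  obtain ⟨K₁, hK₁⟩ := exists_mul_sq_mul_log_le 1 ht0 (div_pos hβ0 hβ'0)
    ((Real.sqrt_lt' ht0).1 ht1)
  obtain ⟨K₂, hK₂⟩ := colorableOn_of_card_le hβ'0 hβ'2
  obtain ⟨K₃, hK₃⟩ := exists_mul_sq_mul_log_le 0 hδ0 (γ := δ ^ 3) (by positivity)
    (pow_lt_pow_right_of_lt_one₀ hδ0 hδ1 (by norm_num))
  -- Keeping `δ c` colours costs at most a factor `δ³` in the bound, and `ℓ = 2 M + 1` will win back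
  -- a factor `M`.
  obtain ⟨M, hM⟩ := exists_nat_ge (1 / δ ^ 3)
  have hM0 : 0 < M := by
    have : (0 : ℝ) < M := (show (0 : ℝ) < 1 / δ ^ 3 by positivity).trans_le hM
    exact_mod_cast this
  rw [div_le_iff₀ (by positivity)] at hM
  set ℓ := 2 * M + 1 with hℓ
  set r := 2 * ℓ ^ 2 + 2 * ℓ with hr
  have hcast := tendsto_natCast_atTop_atTop (R := ℝ)
  obtain ⟨K, hK⟩ := Filter.eventually_atTop.1
    (((hcast.eventually_ge_atTop (r / δ)).and (hcast.eventually_ge_atTop (ℓ / δ))).and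
    (((hcast.eventually_ge_atTop ((K₂ + 1) / t)).and (Filter.eventually_ge_atTop K₁)).and
    (Filter.eventually_ge_atTop (K₃ + 1))))
  refine ⟨1 / (K + 1) ^ 3, by positivity, fun c => ?_⟩
  set η : ℝ := 1 / (K + 1) ^ 3 with hη
  have hη0 : 0 < η := by positivity
  induction c using Nat.strong_induction_on with
  | _ c ih =>
  intro hc2 V _ G hG U hU
  obtain ⟨n₀, hn₀, hcyc₀⟩ := exists_hasCycleIn_gt hc2 hU
  rcases Nat.lt_or_ge c K with hcK | hcK
  · refine ⟨n₀, hcyc₀, hn₀, (min_le_right _ _).trans ?_⟩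
    have h1 : (c : ℝ) ^ 3 ≤ (K + 1) ^ 3 := by
      have : (c : ℝ) ≤ K := by exact_mod_cast hcK.le
      gcongr; linarith
    have h2 : η * c ^ 3 ≤ 1 := by
      rw [hη, one_div, inv_mul_le_iff₀ (by positivity)]; linarith
    have h3 : (1 : ℝ) ≤ n₀ := by exact_mod_cast (by omega : 1 ≤ n₀)
    linarith
  suffices h : ∃ n : ℕ, G.HasCycleIn U n ∧ min (β * c ^ 2 * Real.log c) (η * c ^ 3) ≤ n by
    obtain ⟨n, hn, hle⟩ := h
    rcases Nat.lt_or_ge c n with h | h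
    · exact ⟨n, hn, h, hle⟩
    · exact ⟨n₀, hcyc₀, hn₀, hle.trans (by exact_mod_cast h.trans hn₀.le)⟩
  obtain ⟨⟨k1, k2⟩, ⟨k3, k4⟩, k5⟩ := hK c hcK
  rw [div_le_iff₀ (by positivity)] at k1 k2 k3
  have hrc : r ≤ c := by
    have : (r : ℝ) ≤ c := by nlinarith
    exact_mod_cast this
  obtain ⟨c₀, rfl⟩ := Nat.exists_eq_add_of_le' hrc
  set c := c₀ + r with hc
  have hcr : (c : ℝ) = c₀ + r := by rw [hc]; push_cast; ring
  obtain ⟨W, hWU, hW, hWc⟩ := exists_inseparableOn_not_colorableOn (ℓ := ℓ) (c := c₀) (by omega)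
    (W := U) (by rwa [hc, hr, ← add_assoc] at hU)
  have hfl : (⌊t * c⌋₊ : ℝ) ≤ t * c := Nat.floor_le (by positivity)
  have hfl' : t * c - 1 ≤ ⌊t * c⌋₊ := (Nat.sub_one_lt_floor _).le
  -- Of the `c` colours, `r` pay for inseparability, `a` colour the longest cycle, and `b ≥ δ c`
  -- remain.
  set a := ⌊t * c⌋₊ with ha
  have hac : (a : ℝ) ≤ c₀ - δ * c := by
    rw [hδt] at hfl
    linarith
  have hδc : 0 ≤ δ * c := by positivity
  obtain ⟨b, hb⟩ : ∃ b, c₀ = a + b := Nat.exists_eq_add_of_le (by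
    have : (a : ℝ) ≤ c₀ := by linarith
    exact_mod_cast this)
  have hbδ : δ * c ≤ b := by
    have : (c₀ : ℝ) = a + b := by rw [hb]; push_cast; ring
    linarith
  have hbℓ : ℓ ≤ b := by
    have : (ℓ : ℝ) ≤ b := by linarith
    exact_mod_cast this
  obtain ⟨n₁, hn₁, hcyc₁⟩ := exists_hasCycleIn_gt (by omega) hWc
  obtain ⟨n, hn₁n, hn, hmax⟩ := hcyc₁.exists_longest
  refine ⟨n, hn.mono hWU, ?_⟩
  by_contra! hlt
  have hnβ : (n : ℝ) < β * c ^ 2 * Real.log c := hlt.trans_le (min_le_left _ _)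
  have hnη : (n : ℝ) < η * c ^ 3 := hlt.trans_le (min_le_right _ _)
  classical
  obtain ⟨z, hz, hzW⟩ := hn.exists_isCyclicMap
  set Z := (range n).image z with hZ
  have hZc : G.ColorableOn Z a := by
    refine hK₂ a ?_ G hG Z ?_
    · have : (K₂ : ℝ) ≤ a := by linarith
      exact_mod_cast this
    · rw [hZ, hz.card_image]
      have := hK₁ c k4 a hfl'
      have h2 : β * c ^ 2 * Real.log c = β' * (β / β' * c ^ 2 * Real.log c) := by field_simp
      rw [mul_assoc β']
      refine hnβ.le.trans ?_
      rw [h2]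
      gcongr
  have hrest : ¬ G.ColorableOn ((W \ Z : Finset V) : Set V) b := by
    intro h
    apply hWc
    rw [hb]
    refine (hZc.union h).mono ?_ le_rfl
    rw [← coe_union, coe_subset]
    intro x hx
    rw [mem_union, mem_sdiff]
    tauto
  have hr0 : 0 < r := by rw [hr]; positivity
  obtain ⟨n', hn', hbn', hle⟩ := ih b (by omega) (by omega) G hG _ hrest
  obtain ⟨z', hz', hzW'⟩ := hn'.exists_isCyclicMap
  obtain ⟨m, hm, hmle⟩ := hW.exists_long_cycle (by omega) hz hz'
    (fun i j h => (mem_sdiff.1 (hzW' j)).2 (h ▸ hz.mem_image i)) hzW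
    (fun i => (mem_sdiff.1 (hzW' i)).1) (by omega) (by omega)
  have hmn := hmax m hm
  have hdiv : n / (ℓ - 1) * (2 * M) ≤ n := by
    have := Nat.div_mul_le_self n (ℓ - 1)
    rwa [show ℓ - 1 = 2 * M by omega] at this ⊢
  -- Maximality of `n` bounds the combined cycle, so the loss `n / (ℓ - 1)` is at least the gain `n'
  -- / 2`.
  have hn'2 : n' ≤ 2 * (n / (ℓ - 1)) := by
    have := Nat.div_le_self n (ℓ - 1)
    omega
  have hMn : M * n' ≤ n := by
    calc M * n' ≤ M * (2 * (n / (ℓ - 1))) := Nat.mul_le_mul_left _ hn'2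
      _ = n / (ℓ - 1) * (2 * M) := by ring
      _ ≤ n := hdiv
  have hMn' : (M : ℝ) * n' ≤ n := by exact_mod_cast hMn
  have hc1 : (1 : ℝ) ≤ c := by exact_mod_cast (by omega : 1 ≤ c)
  rcases min_le_iff.1 hle with h | h
  · have h1 := hK₃ c (by omega) b (by linarith)
    have h2 : β * c ^ 2 * Real.log c ≤ M * (β * b ^ 2 * Real.log b) := by
      have hl : 0 ≤ Real.log c := Real.log_nonneg hc1
      calc β * c ^ 2 * Real.log c = 1 * (β * c ^ 2 * Real.log c) := by ring
        _ ≤ (M * δ ^ 3) * (β * c ^ 2 * Real.log c) := by gcongr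
        _ = M * (β * (δ ^ 3 * c ^ 2 * Real.log c)) := by ring
        _ ≤ M * (β * (b ^ 2 * Real.log b)) := by gcongr
        _ = _ := by ring
    have h3 : M * (β * b ^ 2 * Real.log b) ≤ M * n' := by gcongr
    linarith
  · have h2 : η * c ^ 3 ≤ M * (η * b ^ 3) := by
      calc η * c ^ 3 = 1 * (η * c ^ 3) := by ring
        _ ≤ (M * δ ^ 3) * (η * c ^ 3) := by gcongr
        _ = M * (η * (δ * c) ^ 3) := by ring
        _ ≤ M * (η * b ^ 3) := by gcongr
    have h3 : M * (η * b ^ 3) ≤ M * n' := by gcongr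
    linarith

/-- Triangle-free graphs that are not `c`-colourable have cycles of length about
`c² log c / 4`. -/
theorem exists_hasCycleIn_ge {β : ℝ} (hβ0 : 0 < β) (hβ : β < 1 / 4) :
    ∃ K : ℕ, ∀ c : ℕ, K ≤ c → ∀ {V : Type*} [Finite V] (G : SimpleGraph V),
      G.CliqueFree 3 → ∀ U : Finset V, ¬ G.ColorableOn U c →
      ∃ n : ℕ, G.HasCycleIn U n ∧ β * c ^ 2 * Real.log c ≤ n := by
  obtain ⟨η, hη, h⟩ := exists_hasCycleIn_min hβ0 hβ
  have hcast := tendsto_natCast_atTop_atTop (R := ℝ)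
  have e := hcast.eventually (Real.isLittleO_log_id_atTop.bound (show 0 < η / β by positivity))
  obtain ⟨K, hK⟩ := Filter.eventually_atTop.1 (e.and (Filter.eventually_ge_atTop 2))
  refine ⟨K, fun c hc {V} _ G hG U hU => ?_⟩
  obtain ⟨h1, h2⟩ := hK c hc
  obtain ⟨n, hn, -, hle⟩ := h c h2 G hG U hU
  refine ⟨n, hn, ?_⟩
  rwa [min_eq_left] at hle
  have h3 : Real.log c ≤ η / β * c := (le_abs_self _).trans (by simpa using h1)
  calc β * c ^ 2 * Real.log c ≤ β * c ^ 2 * (η / β * c) := by gcongr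
    _ = η * c ^ 3 := by field_simp

/-! ### Breadth-first levels and consecutive cycle lengths. -/

/-- `par` maps every vertex of positive height `D` to a neighbour one level lower. -/
structure IsLevelForest (G : SimpleGraph V) (D : V → ℕ) (par : V → V) : Prop where
  adj_par : ∀ v, D v ≠ 0 → G.Adj v (par v)
  height_par : ∀ v, D v ≠ 0 → D (par v) + 1 = D v
  le_succ : ∀ u v, G.Adj u v → D u ≤ D v + 1

theorem Connected.exists_isLevelForest {G : SimpleGraph V} (hG : G.Connected) :
    ∃ (r : V) (D : V → ℕ) (par : V → V), G.IsLevelForest D par ∧ ∀ v, D v = 0 → v = r := by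
  obtain ⟨r⟩ := hG.nonempty
  have hle : ∀ u v, G.Adj u v → G.dist u r ≤ G.dist v r + 1 := by
    intro u v huv
    have h := hG.dist_triangle (u := u) (v := v) (w := r)
    rw [dist_eq_one_iff_adj.2 huv] at h
    omega
  have hpar : ∀ v, ∃ u, G.dist v r ≠ 0 → G.Adj v u ∧ G.dist u r + 1 = G.dist v r := by
    intro v
    obtain ⟨p, hp⟩ := hG.exists_walk_length_eq_dist v r
    cases p with
    | nil => exact ⟨r, fun h => absurd dist_self h⟩
    | @cons _ u _ h p =>
      refine ⟨u, fun _ => ⟨h, ?_⟩⟩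
      have h1 := dist_le p
      have h2 := hle v u h
      rw [Walk.length_cons] at hp
      omega
  choose par hpar using hpar
  exact ⟨r, fun v => G.dist v r, par, ⟨fun v hv => (hpar v hv).1, fun v hv => (hpar v hv).2, hle⟩,
    fun v hv => hG.dist_eq_zero_iff.1 hv⟩

namespace IsLevelForest

variable {G : SimpleGraph V} {D : V → ℕ} {par : V → V}

theorem height_iterate (h : G.IsLevelForest D par) {v : V} {j : ℕ} (hj : j ≤ D v) :
    D (par^[j] v) + j = D v := by
  induction j with
  | zero => rfl
  | succ j ih =>
    have h1 := ih (by omega)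
    rw [Function.iterate_succ_apply']
    have := h.height_par (par^[j] v) (by omega)
    omega

theorem exists_walk_iterate (h : G.IsLevelForest D par) {v : V} {j : ℕ} (hj : j ≤ D v) :
    ∃ w : G.Walk v (par^[j] v), w.IsPath ∧ w.length = j ∧
      ∀ x ∈ w.support, ∃ i ≤ j, x = par^[i] v := by
  induction j with
  | zero => exact ⟨Walk.nil, Walk.IsPath.nil, rfl, by simp⟩
  | succ j ih =>
    obtain ⟨w, hw, hl, hs⟩ := ih (by omega)
    have h1 := h.height_iterate (v := v) (j := j) (by omega)
    have h2 := h.height_iterate hj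
    have hadj : G.Adj (par^[j] v) (par^[j + 1] v) := by
      rw [Function.iterate_succ_apply']
      exact h.adj_par _ (by omega)
    refine ⟨w.concat hadj, hw.concat (fun hm => ?_) hadj, by rw [Walk.length_concat, hl], ?_⟩
    · obtain ⟨i, hi, hx⟩ := hs _ hm
      have h3 := h.height_iterate (v := v) (j := i) (by omega)
      rw [← hx] at h3
      omega
    · intro x hx
      rw [Walk.support_concat, List.mem_append, List.mem_singleton] at hx
      rcases hx with hx | rfl
      · obtain ⟨i, hi, rfl⟩ := hs x hx
        exact ⟨i, by omega, rfl⟩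
      · exact ⟨j + 1, le_rfl, rfl⟩

/-- Heights identify positions on the two climbs, so these stay disjoint until they merge after `j +
1` steps. The length depends only on `j`, and inner vertices lie on lower levels; both facts serve
to close up cycles. -/
theorem exists_path_between (h : G.IsLevelForest D par) {x y : V} {d j : ℕ} (hj : j + 1 ≤ d)
    (hx : D x = d) (hy : D y = d) (hne : par^[j] x ≠ par^[j] y)
    (heq : par^[j + 1] x = par^[j + 1] y) :
    ∃ w : G.Walk x y, w.IsPath ∧ w.length = 2 * (j + 1) ∧
      ∀ z ∈ w.support, D z = d → z = x ∨ z = y := by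
  obtain ⟨p, hp, hpl, hps⟩ := h.exists_walk_iterate (v := x) (j := j + 1) (by omega)
  obtain ⟨q, hq, hql, hqs⟩ := h.exists_walk_iterate (v := y) (j := j + 1) (by omega)
  refine ⟨p.append (q.copy rfl heq.symm).reverse, ?_, ?_, ?_⟩
  · refine hp.append_of_inter ((Walk.isPath_copy q rfl heq.symm).2 hq).reverse fun z hz hz' => ?_
    rw [Walk.support_reverse, List.mem_reverse, Walk.support_copy] at hz'
    obtain ⟨i, hi, rfl⟩ := hps z hz
    obtain ⟨i', hi', hz'⟩ := hqs _ hz'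
    have h1 := h.height_iterate (v := x) (j := i) (by omega)
    have h2 := h.height_iterate (v := y) (j := i') (by omega)
    rw [← hz'] at h2
    obtain rfl : i = i' := by omega
    rcases Nat.lt_or_ge i (j + 1) with hlt | hge
    · exfalso
      apply hne
      have : j = (j - i) + i := by omega
      rw [this, Function.iterate_add_apply, Function.iterate_add_apply, hz']
    · obtain rfl : i = j + 1 := by omega
      rfl
  · rw [Walk.length_append, Walk.length_reverse, Walk.length_copy, hpl, hql]
    ring
  · intro z hz hzd
    rw [Walk.mem_support_append_iff, Walk.support_reverse, List.mem_reverse,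
      Walk.support_copy] at hz
    rcases hz with hz | hz
    · obtain ⟨i, hi, rfl⟩ := hps z hz
      have h1 := h.height_iterate (v := x) (j := i) (by omega)
      obtain rfl : i = 0 := by omega
      exact Or.inl rfl
    · obtain ⟨i, hi, rfl⟩ := hqs z hz
      have h1 := h.height_iterate (v := y) (j := i) (by omega)
      obtain rfl : i = 0 := by omega
      exact Or.inr rfl

/-- Some level needs at least half of the colours. -/
theorem exists_level_not_colorableOn (h : G.IsLevelForest D par) {q : ℕ}
    (hG : ¬ G.ColorableOn Set.univ (2 * q)) : ∃ d, ¬ G.ColorableOn {v | D v = d} q := by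
  by_contra! hcol
  choose f hf hfp using hcol
  apply hG
  have hlt : ∀ v, f (D v) v < q := fun v => hf (D v) v rfl
  -- Adjacent vertices differ by at most one level, so two palettes alternating with the parity of
  -- the level suffice.
  refine ⟨fun v => f (D v) v + q * (D v % 2), fun v _ => ?_, fun u _ v _ huv heq => ?_⟩
  · have h1 := hlt v
    beta_reduce
    rcases Nat.mod_two_eq_zero_or_one (D v) with h2 | h2 <;> rw [h2] <;> omega
  · beta_reduce at heq
    have h1 := hlt u
    have h2 := hlt v
    have h3 := h.le_succ u v huv
    have h4 := h.le_succ v u huv.symm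
    have h5 : D u % 2 = D v % 2 := by
      rcases Nat.mod_two_eq_zero_or_one (D u) with h6 | h6 <;>
      rcases Nat.mod_two_eq_zero_or_one (D v) with h7 | h7 <;> rw [h6, h7] at heq <;> omega
    have h8 : D u = D v := by omega
    rw [h8] at heq
    exact hfp (D v) u h8 v rfl huv (by simpa using heq)

/-- Let `X` and `Y` be sets in one level of the forest, in different branches of height `j + 1`,
and contained in the connected subset `H` of that level. A cycle in `X` of length `n` gives cycles
of `n` consecutive lengths. -/
theorem exists_consecutive_cycles [Finite V] (h : G.IsLevelForest D par) {d j : ℕ}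
    (hj : j + 1 ≤ d) {H X Y : Finset V} (hH : G.InseparableOn H 1) (hX : X ⊆ H) (hY : Y ⊆ H)
    (hYne : Y.Nonempty) (hd : ∀ v ∈ H, D v = d)
    (heq : ∀ x ∈ H, ∀ y ∈ H, par^[j + 1] x = par^[j + 1] y)
    (hne : ∀ x ∈ X, ∀ y ∈ Y, par^[j] x ≠ par^[j] y) {n : ℕ} (hn : G.HasCycleIn X n) :
    ∃ a, ∀ i < n, ∃ (v : V) (w : G.Walk v v), w.IsCycle ∧ w.length = a + i := by
  classical
  obtain ⟨c, hc, hcX⟩ := hn.exists_isCyclicMap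
  have hn3 := hc.three_le
  obtain ⟨a, b, p, ha, hb, -, -⟩ := hH.linkage (A := (range n).image c) (B := Y)
    (by
      intro x hx
      obtain ⟨i, _, rfl⟩ := Finset.mem_image.1 hx
      exact hX (hcX i)) hY (by rw [hc.card_image]; omega) (card_pos.2 hYne)
  have haH : a 0 ∈ H := by
    obtain ⟨i, _, hi⟩ := Finset.mem_image.1 (ha 0)
    exact hi ▸ hX (hcX i)
  obtain ⟨u, y, w, hu, hy, hw, hs, hA, -⟩ :=
    ((p 0).mapLe (G.restrictTo_le H)).exists_isPath_trim
      (A := ((range n).image c : Finset V)) (B := (Y : Set V)) (ha 0) (hb 0)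
  have hwH : ∀ x ∈ w.support, x ∈ H := fun x hx => by
    have := hs x hx
    rw [Walk.support_mapLe_eq_support] at this
    exact (p 0).mem_of_restrictTo haH x this
  obtain ⟨s, -, rfl⟩ := Finset.mem_image.1 (mem_coe.1 hu)
  refine ⟨2 * (j + 1) + w.length, fun i hi => ?_⟩
  obtain ⟨z, hzl, hzs, hzp⟩ := hc.exists_arc s i
  obtain ⟨T, hT, hTl, hTs⟩ := h.exists_path_between hj (hd _ (hX (hcX (s + i))))
    (hd y (hY hy)) (hne _ (hcX (s + i)) y hy) (heq _ (hX (hcX _)) y (hY hy))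
  -- The tree path `T` returns from `c (s + i)` to `y`, then `w` leads back to the cycle at `c s`,
  -- and the arc `z` of length `i` completes the closed walk. Only `i` varies in its length.
  refine ⟨_, T.append (w.reverse.append z), Walk.IsPath.isCycle_append_of_inter hT
    (hw.reverse.append_of_inter (hzp hi) fun x hx hx' => ?_) (fun x hx hx' => ?_) ?_, ?_⟩
  · obtain ⟨k, _, rfl⟩ := hzs x hx'
    exact hA _ (by simpa using hx) (mem_coe.2 (hc.mem_image _))
  · refine hTs x hx (hd x ?_)
    rw [Walk.mem_support_append_iff, Walk.support_reverse, List.mem_reverse] at hx'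
    rcases hx' with hx' | hx'
    · exact hwH x hx'
    · obtain ⟨k, _, rfl⟩ := hzs x hx'
      exact hX (hcX _)
  · omega
  · rw [Walk.length_append, Walk.length_append, Walk.length_reverse, hTl, hzl]
    ring

end IsLevelForest

/-- A connected graph that is not `4 (q + 2)`-colourable has a subgraph that is not
`q`-colourable, any cycle of which yields as many consecutive cycle lengths as it has vertices. -/
theorem Connected.exists_not_colorableOn_consecutive [Finite V] {G : SimpleGraph V}
    (hG : G.Connected) {q : ℕ} (hq : ¬ G.Colorable (2 * (2 * q + 4))) :
    ∃ X : Finset V, ¬ G.ColorableOn X q ∧ ∀ n, G.HasCycleIn X n →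
      ∃ a, ∀ i < n, ∃ (v : V) (w : G.Walk v v), w.IsCycle ∧ w.length = a + i := by
  classical
  have := Fintype.ofFinite V
  rw [← colorableOn_univ] at hq
  obtain ⟨r, D, par, hF, hr⟩ := hG.exists_isLevelForest
  obtain ⟨d, hd⟩ := hF.exists_level_not_colorableOn hq
  -- For `ℓ = 1` inseparability is connectedness, and the price is `2ℓ² + 2ℓ = 4` colours.
  obtain ⟨H, hHd, hH, hHq⟩ := exists_inseparableOn_not_colorableOn (ℓ := 1) (c := 2 * q)
    one_pos (W := ({v | D v = d} : Finset V)) (by simpa [add_assoc] using hd)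
  have hD : ∀ v ∈ H, D v = d := fun v hv => by simpa using hHd hv
  have hex : ∃ j, j ≤ d ∧ ∀ x ∈ H, ∀ y ∈ H, par^[j] x = par^[j] y := by
    refine ⟨d, le_rfl, fun x hx y hy => ?_⟩
    have h0 : ∀ x ∈ H, par^[d] x = r := fun x hx =>
      hr _ (by have := hF.height_iterate (v := x) (j := d) (hD x hx).ge; have := hD x hx; omega)
    rw [h0 x hx, h0 y hy]
  obtain ⟨hjd, hjeq⟩ := Nat.find_spec hex
  have hmin := fun m (hm : m < Nat.find hex) => Nat.find_min hex hm
  generalize Nat.find hex = j at hjd hjeq hmin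
  -- An acyclic set that is not `q`-colourable satisfies the claim vacuously. Otherwise `H` contains
  -- a cycle, so it has two vertices and `j` is positive.
  by_cases hX : ∃ X, ¬ G.ColorableOn (X : Finset V) q ∧ ∀ n, ¬ G.HasCycleIn X n
  · obtain ⟨X, hX, hno⟩ := hX
    exact ⟨X, hX, fun n hn => absurd hn (hno n)⟩
  push Not at hX
  obtain ⟨n₀, v₀, w₀, hw₀, -, hw₀H⟩ := hX H (fun h => hHq (h.mono subset_rfl (by omega)))
  have hedge : ∃ x ∈ H, ∃ y ∈ H, x ≠ y := by
    cases w₀ with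
    | nil => exact absurd hw₀ Walk.not_isCycle_nil
    | @cons _ y _ h p => exact ⟨v₀, hw₀H v₀ (by simp), y, hw₀H y (by simp), h.ne⟩
  cases j with
  | zero =>
    obtain ⟨x, hx, y, hy, hxy⟩ := hedge
    exact absurd (hjeq x hx y hy) hxy
  | succ j =>
    have hj := hmin j (Nat.lt_succ_self j)
    push Not at hj
    obtain ⟨x, hx, y, hy, hxy⟩ := hj (by omega)
    set A := {z ∈ H | par^[j] z = par^[j] x} with hA
    set B := {z ∈ H | par^[j] z ≠ par^[j] x} with hB
    have hAB : ∀ a ∈ A, ∀ b ∈ B, par^[j] a ≠ par^[j] b := by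
      intro a ha b hb
      rw [(mem_filter.1 ha).2]
      exact (mem_filter.1 hb).2.symm
    have hor : ¬ G.ColorableOn A q ∨ ¬ G.ColorableOn B q := by
      by_contra! hcol
      apply hHq
      have := hcol.1.union hcol.2
      rw [← two_mul, ← coe_union, filter_union_filter_not_eq] at this
      exact this
    rcases hor with h | h
    · exact ⟨A, h, fun n hn => hF.exists_consecutive_cycles (X := A) (Y := B) hjd hH (filter_subset _ _)
        (filter_subset _ _) ⟨y, mem_filter.2 ⟨hy, hxy.symm⟩⟩ hD hjeq hAB hn⟩
    · exact ⟨B, h, fun n hn => hF.exists_consecutive_cycles (X := B) (Y := A) hjd hH (filter_subset _ _)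
        (filter_subset _ _) ⟨x, mem_filter.2 ⟨hx, rfl⟩⟩ hD hjeq
        (fun b hb a ha => (hAB a ha b hb).symm) hn⟩

/-! ### Reduction to finite connected graphs, and the final constants. -/

/-- The de Bruijn–Erdős theorem. -/
theorem exists_finite_subgraph_not_colorable {G : SimpleGraph V} {n : ℕ} (hG : ¬ G.Colorable n) :
    ∃ G' : G.Subgraph, G'.verts.Finite ∧ ¬ G'.coe.Colorable n := by
  by_contra! h
  exact hG (nonempty_hom_of_forall_finite_subgraph_hom fun G' hG' =>
    Classical.choice (h G' hG'))

theorem CliqueFree.of_hom_three {W : Type*} {G : SimpleGraph V} {H : SimpleGraph W} (f : H →g G)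
    (hG : G.CliqueFree 3) : H.CliqueFree 3 := by
  classical
  intro s hs
  obtain ⟨a, b, c, hab, hac, hbc, -⟩ := is3Clique_iff.1 hs
  exact not_adj_of_common_neighbor hG (f.map_adj hab) (f.map_adj hac) (f.map_adj hbc)

end SimpleGraph

open SimpleGraph in
theorem theorem1 (ε : ℝ) (hε : 0 < ε) :
    ∃ k₀ : ℕ, ∀ k : ℕ, k₀ ≤ k →
      ∀ (V : Type*) (G : SimpleGraph V), G.CliqueFree 3 → G.chromaticNumber = (k : ℕ∞) →
        (∃ (v : V) (c : G.Walk v v), c.IsCycle ∧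
          (1 / 4 - ε) * (k : ℝ) ^ 2 * Real.log (k : ℝ) ≤ (c.length : ℝ)) ∧
        (∃ a m : ℕ, (1 / 64 - ε) * (k : ℝ) ^ 2 * Real.log (k : ℝ) ≤ (m : ℝ) ∧
          ∀ i : ℕ, i < m → ∃ (v : V) (c : G.Walk v v), c.IsCycle ∧ c.length = a + i) := by
  -- One factor `θ` keeps `β = θ / 4` below `1/4`; the other pays for replacing `k` by `k - 1`, or
  -- `k / 4` by `q`.
  obtain ⟨θ, hθ0, hθ1, hθε⟩ : ∃ θ : ℝ, 0 < θ ∧ θ < 1 ∧ 1 - ε ≤ θ ^ 2 := by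
    refine ⟨1 - min (ε / 2) (1 / 2), ?_, ?_, ?_⟩
    · linarith [min_le_right (ε / 2) (1 / 2)]
    · linarith [lt_min (half_pos hε) (one_half_pos (α := ℝ))]
    · nlinarith [min_le_left (ε / 2) (1 / 2), sq_nonneg (min (ε / 2) (1 / 2))]
  obtain ⟨K₁, hK₁⟩ := exists_hasCycleIn_ge (β := θ / 4) (by linarith) (by linarith)
  obtain ⟨K₂, hK₂⟩ := exists_mul_sq_mul_log_le 1 (t := 1) (γ := θ) one_pos hθ0 (by linarith)
  obtain ⟨K₃, hK₃⟩ := exists_mul_sq_mul_log_le 3 (t := 1 / 4) (γ := θ / 16) (by norm_num)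
    (by linarith) (by linarith)
  refine ⟨max (max K₂ K₃) (4 * K₁ + 13), fun k hk V G hG hχ => ?_⟩
  have hk2 : K₂ ≤ k := ((le_max_left _ _).trans (le_max_left _ _)).trans hk
  have hk3 : K₃ ≤ k := ((le_max_right _ _).trans (le_max_left _ _)).trans hk
  have hk4 : 4 * K₁ + 13 ≤ k := (le_max_right _ _).trans hk
  have hnc : ¬ G.Colorable (k - 1) := by
    intro h
    have := h.chromaticNumber_le
    rw [hχ, Nat.cast_le] at this
    omega
  obtain ⟨G', hfin, hG'⟩ := exists_finite_subgraph_not_colorable hnc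
  rw [colorable_iff_forall_connectedComponent] at hG'
  push Not at hG'
  obtain ⟨C, hC⟩ := hG'
  have : Finite G'.verts := hfin
  have := Fintype.ofFinite C
  have hconn := C.connected_toSimpleGraph
  let φ : C.toSimpleGraph →g G := G'.hom.comp C.toSimpleGraph_hom
  have hφ : Function.Injective φ := by
    intro x y hxy
    exact Subtype.ext (Subtype.ext hxy)
  have hH := hG.of_hom_three φ
  have hlog : 0 ≤ (k : ℝ) ^ 2 * Real.log k := by
    have : (1 : ℝ) ≤ k := by exact_mod_cast (by omega : 1 ≤ k)
    exact mul_nonneg (sq_nonneg _) (Real.log_nonneg this)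
  constructor
  · obtain ⟨n, ⟨v, w, hw, rfl, -⟩, hle⟩ := hK₁ (k - 1) (by omega) C.toSimpleGraph hH Finset.univ
      (by rwa [Finset.coe_univ, colorableOn_univ])
    refine ⟨_, w.map φ, (Walk.isCycle_map_iff_of_injective hφ).2 hw, ?_⟩
    rw [Walk.length_map]
    refine le_trans ?_ hle
    have h1 := hK₂ k hk2 ((k - 1 : ℕ) : ℝ) (by
      rw [Nat.cast_sub (by omega)]
      push_cast
      linarith)
    calc (1 / 4 - ε) * (k : ℝ) ^ 2 * Real.log k = (1 / 4 - ε) * (k ^ 2 * Real.log k) := by ring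
      _ ≤ (θ ^ 2 / 4) * (k ^ 2 * Real.log k) := by gcongr; linarith
      _ = θ / 4 * (θ * k ^ 2 * Real.log k) := by ring
      _ ≤ θ / 4 * (((k - 1 : ℕ) : ℝ) ^ 2 * Real.log ((k - 1 : ℕ) : ℝ)) := by gcongr
      _ = _ := by ring
  -- The largest `q` with `2 (2 q + 4) ≤ k - 1`.
  · set q := (k - 9) / 4 with hq
    obtain ⟨X, hX, hcons⟩ := hconn.exists_not_colorableOn_consecutive (q := q)
      (fun h => hC (h.mono (by omega)))
    obtain ⟨n, hn, hle⟩ := hK₁ q (by omega) C.toSimpleGraph hH X hX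
    obtain ⟨a, ha⟩ := hcons n hn
    refine ⟨a, n, le_trans ?_ hle, fun i hi => ?_⟩
    · have h1 := hK₃ k hk3 q (by
        have : k ≤ 4 * q + 12 := by omega
        have : (k : ℝ) ≤ 4 * q + 12 := by exact_mod_cast this
        linarith)
      calc (1 / 64 - ε) * (k : ℝ) ^ 2 * Real.log k = (1 / 64 - ε) * (k ^ 2 * Real.log k) := by ring
        _ ≤ (θ ^ 2 / 64) * (k ^ 2 * Real.log k) := by gcongr; linarith
        _ = θ / 4 * (θ / 16 * k ^ 2 * Real.log k) := by ring
        _ ≤ θ / 4 * ((q : ℝ) ^ 2 * Real.log q) := by gcongr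
        _ = _ := by ring
    · obtain ⟨v, w, hw, hl⟩ := ha i hi
      exact ⟨_, w.map φ, (Walk.isCycle_map_iff_of_injective hφ).2 hw, by rw [Walk.length_map, hl]⟩
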